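/- Let $\mathbb H$ be the closure in $L^2(\mathbb R^3)^3$ (real vector fields) of the smooth compactly supported divergence-free fields, with the $L^2$ norm $\|\cdot\|$, and let $\mathbb P$ be the orthogonal (Leray) projection of $L^2(\mathbb R^3)^3$ onto $\mathbb H$. Let $A u=-\mathbb P\Delta u$ with domain $D(A)=\mathbb H\cap H^2(\mathbb R^3)^3$ (the Stokes operator), and let $B u=\tfrac12\mathbb P(-\Delta+|x|^2)u$ with domain $\{u\in\mathbb H\cap H^2(\mathbb R^3)^3 : |x|^2u\in L^2\}$ (the Hermite-Stokes operator). $B$ is positive and self-adjoint with compact inverse; let $\lambda_1>0$ be its smallest eigenvalue, and for $\beta>0$ let $B^{-\beta}w=\sum_k\lambda_k^{-\beta}\langle e_k,w\rangle e_k$, where $(e_k)$ is an orthonormal basis of $\mathbb H$ consisting of eigenvectors, $Be_k=\lambda_ke_k$. On $\mathbb H$ the operator $A$ is the Fourier multiplier $|\xi|^2$ (Fourier transform $\hat F(\xi)=(2\pi)^{-3/2}\int e^{-i\langle x,\xi\rangle}F(x)\,dx$), so $A^{-\beta}$ is the multiplier $|\xi|^{-2\beta}$. Put $(AB)^{-\beta}=B^{-\beta}A^{-\beta}$,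 where $B^{-\beta}$ is applied by duality, because $A^{-\beta}F$ need not be in $L^2$: for $F\in\mathbb H$, an element $z\in\mathbb H$ equals $(AB)^{-\beta}F$ if for all $w\in\mathbb H$ $$\langle z,w\rangle=\int_{\mathbb R^3}|\xi|^{-2\beta}\,\hat F(\xi)\cdot\overline{\widehat{B^{-\beta}w}(\xi)}\,d\xi ,$$ the integral being absolutely convergent. For $u,v\in D(A)$ let $C(u,v)=\mathbb P\,(u\cdot\nabla)v\in\mathbb H$. Theorem. Let $0<\varepsilon<\tfrac12$ and $\delta=\tfrac14+\tfrac{\varepsilon}{2}$. There is a constant $c>0$, depending only on $\varepsilon$, such that the following holds. For all $u,v\in D(A)$ the element $(AB)^{-(1+\delta)}C(u,v)$ of $\mathbb H$ exists; the map $(u,v)\mapsto(AB)^{-(1+\delta)}C(u,v)$ extends (uniquely, since $D(A)$ is dense in $\mathbb H$) to a bounded bilinear map $\mathbb H\times\mathbb H\to\mathbb H$, denoted by the same symbol; and for all $u,v,w\in\mathbb H$ $$\left|\left\langle (AB)^{-(1+\delta)}C(u,v),w\right\rangle\right|\le c\,\lambda_1^{-(1+\delta)}\,\|u\|\,\|v\|\,\|w\|.$$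 -/

import Mathlib

open MeasureTheory FourierTransform
open scoped ContDiff

noncomputable section

namespace HermiteStokes

/-- Three-dimensional Euclidean space. -/
abbrev E3 : Type := EuclideanSpace ℝ (Fin 3)

/-- The complexification `ℂ³` of the space of values of vector fields. -/
abbrev C3 : Type := EuclideanSpace ℂ (Fin 3)

/-- The real Hilbert space `L²(ℝ³)³` of square integrable vector fields on `ℝ³`. -/
abbrev L2 : Type := Lp E3 2 (volume : Measure E3)

/-- The `i`-th standard basis vector of `ℝ³`. -/
def basisVec (i : Fin 3) : E3 := EuclideanSpace.single i 1

/-- The (classical) divergence of a vector field. -/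
def divergence (φ : E3 → E3) (x : E3) : ℝ := ∑ i, (fderiv ℝ φ x (basisVec i)) i

/-- The classes in `L²` of the smooth compactly supported divergence free vector fields. -/
def solenoidalTest : Set L2 :=
  {f | ∃ φ : E3 → E3, ContDiff ℝ ∞ φ ∧ HasCompactSupport φ ∧ (∀ x, divergence φ x = 0) ∧
    (f : E3 → E3) =ᵐ[volume] φ}

/-- The space `ℍ` of solenoidal fields: the closure in `L²` of the smooth compactly supported
divergence free fields. (These already form a linear subspace.) -/
def H : Submodule ℝ L2 := (Submodule.span ℝ solenoidalTest).topologicalClosure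

instance instCompleteSpaceH : CompleteSpace H :=
  inferInstanceAs (CompleteSpace (Submodule.span ℝ solenoidalTest).topologicalClosure)

/-- The Leray projection `ℙ`: the orthogonal projection of `L²` onto `ℍ`. -/
def leray : L2 →L[ℝ] H := H.orthogonalProjectionOnto

/-- `g` is the weak partial derivative `∂ⱼ f`; both are square integrable fields. -/
def IsWeakPartial (j : Fin 3) (f g : L2) : Prop :=
  ∀ φ : E3 → ℝ, ContDiff ℝ ∞ φ → HasCompactSupport φ →
    ∫ x, (fderiv ℝ φ x (basisVec j)) • (f : E3 → E3) x = -∫ x, φ x • (g : E3 → E3) x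

/-- `u` lies in the Sobolev space `H²(ℝ³)³` and `Δu = L`. -/
def IsWeakLaplacian (u L : L2) : Prop :=
  ∃ (G : Fin 3 → L2) (K : Fin 3 → Fin 3 → L2),
    (∀ i, IsWeakPartial i u (G i)) ∧ (∀ i j, IsWeakPartial j (G i) (K i j)) ∧
      L = ∑ i, K i i

/-- The Stokes operator as a graph: `u ∈ D(A) = ℍ ∩ H²` and `Au = -ℙΔu = g`. -/
def IsStokes (u g : H) : Prop := ∃ L : L2, IsWeakLaplacian (u : L2) L ∧ g = leray (-L)

/-- The domain `D(A)` of the Stokes operator. -/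
def stokesDomain : Set H := {u | ∃ g : H, IsStokes u g}

/-- The Hermite-Stokes operator as a graph: `u ∈ D(B)`, i.e. `u` is in `ℍ ∩ H²` and `|x|²u` is
square integrable, and `Bu = (1/2) ℙ(-Δ + |x|²)u = g`. -/
def IsHermiteStokes (u g : H) : Prop :=
  ∃ L X : L2, IsWeakLaplacian (u : L2) L ∧
    (X : E3 → E3) =ᵐ[volume] (fun x => ‖x‖ ^ 2 • ((u : L2) : E3 → E3) x) ∧
    g = (1 / 2 : ℝ) • leray (-L + X)

/-- The set of eigenvalues of `B`. -/
def eigenvaluesB : Set ℝ := {μ | ∃ u : H, u ≠ 0 ∧ IsHermiteStokes u (μ • u)}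

/-- The first eigenvalue `λ₁` of `B`. -/
def lambda1 : ℝ := sInf eigenvaluesB

/-- The eigenspace of `B` for the value `μ`. (The eigenvectors with `0` already form a closed
linear subspace.) -/
def eigenspaceB (μ : ℝ) : Submodule ℝ H :=
  (Submodule.span ℝ {u : H | IsHermiteStokes u (μ • u)}).topologicalClosure

instance instCompleteSpaceEigenspaceB (μ : ℝ) : CompleteSpace (eigenspaceB μ) :=
  inferInstanceAs (CompleteSpace
    (Submodule.span ℝ {u : H | IsHermiteStokes u (μ • u)}).topologicalClosure)

/-- The negative power `B^{-β} w = ∑ μ^{-β} E_μ w`, the sum being over the eigenvalues `μ` of `B`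
and `E_μ` being the orthogonal projection onto the eigenspace. Since `B` is positive with compact
inverse, this is the expansion in an orthonormal basis of eigenvectors. -/
def negPowB (β : ℝ) (w : H) : H :=
  ∑' μ : eigenvaluesB, (μ : ℝ) ^ (-β) • (eigenspaceB (μ : ℝ)).starProjection w

/-- The inclusion `ℝ³ → ℂ³`. -/
def toC3 : E3 →L[ℝ] C3 :=
  LinearMap.toContinuousLinearMap
    { toFun := fun x => WithLp.toLp 2 (fun i => ((x i : ℝ) : ℂ))
      map_add' := by intro x y; ext i; simp
      map_smul' := by intro a x; ext i; simp }

/-- The `L²` Fourier transform of a field `F`, in the normalization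
`∫ exp(-2πi⟨x,ξ⟩) F(x) dx`. -/
def fourierField (F : H) : Lp C3 2 (volume : Measure E3) := 𝓕 (toC3.compLp (F : L2))

/-- The Fourier transform of `A^{-β} F`. On `ℍ` the projection `ℙ` commutes with `Δ`, so `A` is
multiplication of the Fourier transform by `(2π|ξ|)²`, and `A^{-β}` is the Riesz potential, that is
multiplication by `(2π|ξ|)^{-2β}`. The product is a function on frequency space for every `F`; it
is square integrable exactly if `F` is in the domain of `A^{-β}` as an operator in `ℍ`. -/
def fourierNegPowA (β : ℝ) (F : H) (ξ : E3) : C3 :=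
  (((2 * Real.pi * ‖ξ‖) ^ (-(2 * β)) : ℝ) : ℂ) • (fourierField F : E3 → C3) ξ

/-- `z = (AB)^{-β} F = B^{-β} A^{-β} F`, where the self-adjoint operator `B^{-β}` is applied to
the field `A^{-β} F` by duality: `⟨z, w⟩ = ⟨A^{-β} F, B^{-β} w⟩` for all `w` in `ℍ`, the right
side being an absolutely convergent Parseval integral. If `A^{-β} F` is in `ℍ`, this says that `z`
is the value of the operator `B^{-β}` at `A^{-β} F`. -/
def IsNegPowAB (β : ℝ) (F z : H) : Prop :=
  ∀ w : H,
    Integrable (fun ξ : E3 =>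
      inner ℂ (fourierNegPowA β F ξ) ((fourierField (negPowB β w) : E3 → C3) ξ)) ∧
    inner ℝ z w = (∫ ξ : E3,
      inner ℂ (fourierNegPowA β F ξ) ((fourierField (negPowB β w) : E3 → C3) ξ)).re

/-- `F = C(u, v) = ℙ (u · ∇)v`, where `v` has square integrable weak partial derivatives and
`(u · ∇)v = ∑ uᵢ ∂ᵢv` is square integrable. -/
def IsConvection (u v F : H) : Prop :=
  ∃ (G : Fin 3 → L2) (f : L2), (∀ i, IsWeakPartial i (v : L2) (G i)) ∧
    (f : E3 → E3) =ᵐ[volume]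
      (fun x => ∑ i, (((u : L2) : E3 → E3) x) i • (G i : E3 → E3) x) ∧
    F = leray f

end HermiteStokes

end

/-! For solenoidal `u` the convection term is a divergence, `(u · ∇)v = ∑ ∂ᵢ(uᵢ v)`. Each `uᵢ v` has
`L¹` norm at most `‖u‖ ‖v‖`, so its Fourier transform is bounded, and that of the convection term is
`O(|ξ| ‖u‖ ‖v‖)` (`fourierL2_convection`, `norm_fourierConv_le`). Against a solenoidal field the
projection `ℙ` drops out, even frequency by frequency (`inner_fourierL2_leray`). With `β = 1 + δ`
and `h = B^{-β} w`, the pairing is therefore at most a constant times `‖u‖ ‖v‖ ∫ |ξ|^{1-2β} |ĥ(ξ)|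
dξ`, in which no derivative of `u` or `v` is left.

To bound this integral, split `|ξ|^s |ĥ|`, `s = 1 - 2β`, by Cauchy-Schwarz into the weight
`|ξ|^{2s+2} / (1 + |ξ|²)` and `(1 + |ξ|⁻²) |ĥ|²` (`integral_rpow_mul_fourierL2_le`). In dimension
three the weight is integrable for `-5/2 < s < -3/2`, that is `5/4 < β < 7/4`; the theorem has `β =
5/4 + ε/2`. The singular part `∫ |ξ|⁻² |ĥ|²` is controlled by the second moment `∫ |x|² |h|²`
through Hardy's inequality on the frequency side (`lintegral_hardy_fourier`). The second moment is
at most `2⟨Bh, h⟩`, which for `h = B^{-β} w` is bounded by `2 λ₁^{1-2β} ‖w‖²` (`moment_negPowB_le`).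

Of the spectral theory of `B` only two facts are used: eigenspaces of distinct eigenvalues are
orthogonal, and every eigenvalue is at least `1/2`, by an uncertainty principle that again comes
from Hardy. Compactness of the inverse and completeness of the eigenvectors are not needed.

The trilinear form makes sense for all `u, v, w` in `ℍ`, so the Riesz representation yields the
bounded bilinear map directly (`exists_bilinear_of_trilinear`). On `D(A)`, where `u` is bounded by
the Sobolev embedding and `(u · ∇)v` is in `L²`, it agrees with the duality definition
(`exists_isConvection`). -/

noncomputable section

namespace HermiteStokes

open SchwartzMap Filter Topology ENNReal

/-! ### The `L²` Fourier transform compared with the Fourier integral -/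

section FourierLp

variable {F : Type*} [NormedAddCommGroup F] [InnerProductSpace ℂ F]

theorem continuous_fourier_of_integrable {g : E3 → F} (hg : Integrable g) :
    Continuous (𝓕 g) :=
  VectorFourier.fourierIntegral_continuous Real.continuous_fourierChar continuous_inner hg

theorem norm_fourierInv_le (g : E3 → F) (x : E3) : ‖(𝓕⁻ g) x‖ ≤ ∫ v, ‖g v‖ := by
  rw [Real.fourierInv_eq_fourier_neg]
  exact VectorFourier.norm_fourierIntegral_le_integral_norm _ _ _ _ _

variable [CompleteSpace F]

/-- The Fourier transform on `L²` is symmetric with respect to the pairing with Schwartz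
functions. -/
theorem integral_schwartz_smul_fourier (f : Lp F 2 (volume : Measure E3)) (φ : 𝓢(E3, ℂ)) :
    ∫ x, φ x • (𝓕 f : Lp F 2 (volume : Measure E3)) x = ∫ x, (𝓕 φ) x • f x := by
  have h := congrArg (fun T => T φ) (Lp.fourier_toTemperedDistribution_eq f)
  simp only [TemperedDistribution.fourier_apply, Lp.toTemperedDistribution_apply] at h
  exact h.symm

/-- A locally integrable function that satisfies the duality relation of the Fourier transform
of `f` against compactly supported smooth functions is the Fourier transform of `f`. -/
theorem fourier_ae_eq_of_pairing (f : Lp F 2 (volume : Measure E3)) {h : E3 → F}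
    (hh : LocallyIntegrable h volume)
    (H : ∀ φ : 𝓢(E3, ℂ), HasCompactSupport φ → ∫ x, (𝓕 φ) x • f x = ∫ x, φ x • h x) :
    (𝓕 f : Lp F 2 (volume : Measure E3)) =ᵐ[volume] h := by
  refine ae_eq_of_integral_contDiff_smul_eq
    ((Lp.memLp _).locallyIntegrable (by norm_num)) hh fun g hg hgc => ?_
  have hg₁ : HasCompactSupport (Complex.ofRealCLM ∘ g) := hgc.comp_left rfl
  have hg₂ : ContDiff ℝ ∞ (Complex.ofRealCLM ∘ g) := by fun_prop
  have e1 := integral_schwartz_smul_fourier f (hg₁.toSchwartzMap hg₂)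
  have e2 := H (hg₁.toSchwartzMap hg₂) hg₁
  simpa using e1.trans e2

theorem integral_fourier_smul_of_integrable {φ : E3 → ℂ} {g : E3 → F} (hφ : Integrable φ)
    (hg : Integrable g) : ∫ x, (𝓕 φ) x • g x = ∫ x, φ x • (𝓕 g) x := by
  have := VectorFourier.integral_fourierIntegral_smul_eq_flip (μ := volume) (ν := volume)
    (L := innerₗ E3) Real.continuous_fourierChar continuous_inner hφ hg
  rw [flip_innerₗ] at this
  exact this

/-- On `L¹ ∩ L²` the `L²` Fourier transform is the Fourier integral. -/
theorem fourier_ae_eq_fourierIntegral (f : Lp F 2 (volume : Measure E3))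
    (hf : Integrable f) :
    (𝓕 f : Lp F 2 (volume : Measure E3)) =ᵐ[volume] 𝓕 (f : E3 → F) := by
  refine fourier_ae_eq_of_pairing f (continuous_fourier_of_integrable hf).locallyIntegrable
    fun φ _ => ?_
  exact integral_fourier_smul_of_integrable φ.integrable hf

/-- A square integrable function with integrable Fourier transform is essentially bounded. -/
theorem ae_norm_le_of_integrable_fourier (f : Lp F 2 (volume : Measure E3))
    (hf : Integrable (𝓕 f : Lp F 2 (volume : Measure E3))) :
    ∀ᵐ x, ‖f x‖ ≤ ∫ ξ, ‖(𝓕 f : Lp F 2 (volume : Measure E3)) ξ‖ := by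
  set h : E3 → F := ((𝓕 f : Lp F 2 (volume : Measure E3)) : E3 → F) with hdef
  -- Fourier inversion, by duality: both sides have the same integral against every test function
  -- `φ`, since `φ` is the Fourier transform of the Schwartz function `𝓕⁻ φ`.
  have key : (f : E3 → F) =ᵐ[volume] 𝓕⁻ h := by
    have hc : Continuous (𝓕⁻ h) := by
      rw [Real.fourierInv_eq_fourier_comp_neg]
      exact continuous_fourier_of_integrable hf.comp_neg
    refine ae_eq_of_integral_contDiff_smul_eq
      ((Lp.memLp _).locallyIntegrable (by norm_num)) hc.locallyIntegrable fun g hg hgc => ?_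
    have hg₁ : HasCompactSupport (Complex.ofRealCLM ∘ g) := hgc.comp_left rfl
    have hg₂ : ContDiff ℝ ∞ (Complex.ofRealCLM ∘ g) := by fun_prop
    set φ : 𝓢(E3, ℂ) := hg₁.toSchwartzMap hg₂ with hφ
    have hφg : ∀ x, φ x = (g x : ℂ) := fun x => rfl
    have e1 := integral_schwartz_smul_fourier f (𝓕⁻ φ)
    rw [FourierInvPair.fourier_fourierInv_eq] at e1
    have e2 : ∫ x, φ x • (𝓕⁻ h) x = ∫ x, (𝓕⁻ φ) x • h x := by
      have e3 := integral_fourier_smul_of_integrable (φ := fun x => φ (-x)) (g := h)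
        φ.integrable.comp_neg hf
      have e4 : ((𝓕⁻ φ : 𝓢(E3, ℂ)) : E3 → ℂ) = 𝓕 (fun x => φ (-x)) := by
        rw [SchwartzMap.fourierInv_coe, Real.fourierInv_eq_fourier_comp_neg]
      rw [e4, e3, ← integral_neg_eq_self]
      simp_rw [Real.fourierInv_eq_fourier_neg, neg_neg]
    have e5 := e1.symm.trans e2.symm
    simpa [hφg] using e5
  filter_upwards [key] with x hx
  rw [hx]
  exact norm_fourierInv_le _ _

/-- An integrable function with vanishing Fourier integral vanishes almost everywhere. -/
theorem ae_eq_zero_of_fourier_eq_zero {q : E3 → F} (hq : Integrable q) (h0 : ∀ y, (𝓕 q) y = 0) :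
    q =ᵐ[volume] 0 := by
  refine ae_eq_zero_of_integral_contDiff_smul_eq_zero hq.locallyIntegrable fun g hg hgc => ?_
  have hg₁ : HasCompactSupport (Complex.ofRealCLM ∘ g) := hgc.comp_left rfl
  have hg₂ : ContDiff ℝ ∞ (Complex.ofRealCLM ∘ g) := by fun_prop
  set φ : 𝓢(E3, ℂ) := hg₁.toSchwartzMap hg₂ with hφ
  have e := integral_fourier_smul_of_integrable (φ := ((𝓕⁻ φ : 𝓢(E3, ℂ)) : E3 → ℂ)) (𝓕⁻ φ).integrable hq
  have e4 : 𝓕 ((𝓕⁻ φ : 𝓢(E3, ℂ)) : E3 → ℂ) = φ := by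
    rw [← SchwartzMap.fourier_coe, FourierInvPair.fourier_fourierInv_eq]
  rw [e4] at e
  simpa [h0, hφ] using e

end FourierLp

/-! ### Real fields as complex fields; Parseval -/

section Complexify

theorem toC3_apply (x : E3) (i : Fin 3) : toC3 x i = ((x i : ℝ) : ℂ) := rfl

theorem inner_toC3 (x y : E3) : inner ℂ (toC3 x) (toC3 y) = ((inner ℝ x y : ℝ) : ℂ) := by
  simp [PiLp.inner_apply, toC3_apply]

theorem norm_toC3 (x : E3) : ‖toC3 x‖ = ‖x‖ := by
  have h := inner_toC3 x x
  rw [inner_self_eq_norm_sq_to_K, real_inner_self_eq_norm_sq] at h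
  have h2 : ‖toC3 x‖ ^ 2 = ‖x‖ ^ 2 := by
    apply Complex.ofReal_injective
    simpa using h
  exact (sq_eq_sq₀ (norm_nonneg _) (norm_nonneg _)).1 h2

/-- The Fourier transform of a real square integrable field, as a real linear isometry. -/
def fourierL2 : L2 →ₗᵢ[ℝ] Lp C3 2 (volume : Measure E3) where
  toFun f := 𝓕 (toC3.compLp f)
  map_add' f g := by
    rw [← FourierTransform.fourier_add]
    congr 1
    exact (toC3.compLpₗ 2 volume).map_add f g
  map_smul' a f := by
    -- The Fourier transform is linear over `ℂ`, so the real scalar passes through it in its complex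
    -- form.
    have h : toC3.compLp (a • f) = (a : ℂ) • toC3.compLp f := by
      have := (toC3.compLpₗ 2 (volume : Measure E3)).map_smul a f
      rw [show toC3.compLp (a • f) = a • toC3.compLp f from this]
      ext1
      filter_upwards [Lp.coeFn_smul a (toC3.compLp f),
        Lp.coeFn_smul (a : ℂ) (toC3.compLp f)] with x h1 h2
      rw [h1, h2]
      simp
    rw [h, FourierTransform.fourier_smul]
    ext1
    filter_upwards [Lp.coeFn_smul a (𝓕 (toC3.compLp f) : Lp C3 2 (volume : Measure E3)),
        Lp.coeFn_smul (a : ℂ) (𝓕 (toC3.compLp f) : Lp C3 2 (volume : Measure E3))] with x h1 h2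
    simp only [RingHom.id_apply]
    rw [h1, h2]
    simp
  norm_map' f := by
    change ‖(𝓕 (toC3.compLp f) : Lp C3 2 (volume : Measure E3))‖ = ‖f‖
    rw [Lp.norm_fourier_eq, Lp.norm_def, Lp.norm_def]
    congr 1
    refine eLpNorm_congr_norm_ae ?_
    filter_upwards [toC3.coeFn_compLp f] with x hx
    rw [hx, norm_toC3]

theorem fourierL2_apply (f : L2) : fourierL2 f = 𝓕 (toC3.compLp f) := rfl

theorem fourierField_eq (u : H) : fourierField u = fourierL2 (u : L2) := rfl

/-- Parseval's identity for real fields. -/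
theorem integral_inner_fourierL2 (f g : L2) :
    ∫ ξ, inner ℂ (fourierL2 f ξ) (fourierL2 g ξ) = ((inner ℝ f g : ℝ) : ℂ) := by
  have h1 : inner ℂ (fourierL2 f) (fourierL2 g) =
      inner ℂ (toC3.compLp f) (toC3.compLp g) := Lp.inner_fourier_eq _ _
  rw [L2.inner_def] at h1
  rw [h1, L2.inner_def, L2.inner_def, ← integral_complex_ofReal]
  refine integral_congr_ae ?_
  filter_upwards [toC3.coeFn_compLp f, toC3.coeFn_compLp g] with x hf hg
  rw [hf, hg, inner_toC3]

theorem integrable_inner_fourierL2 (f g : L2) :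
    Integrable fun ξ => inner ℂ (fourierL2 f ξ) (fourierL2 g ξ) :=
  L2.integrable_inner (fourierL2 f) (fourierL2 g)

end Complexify

/-! ### Weak derivatives as Fourier multipliers; the Sobolev embedding -/

section WeakDerivative

theorem integrable_smul_of_memLp_two {𝕜 F : Type*} [NormedRing 𝕜] [NormedAddCommGroup F]
    [MulActionWithZero 𝕜 F] [IsBoundedSMul 𝕜 F] {φ : E3 → 𝕜} {f : E3 → F}
    (hφ : MemLp φ 2 volume) (hf : MemLp f 2 volume) : Integrable fun x => φ x • f x :=
  memLp_one_iff_integrable.1 (hf.smul hφ)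

/-- The defining identity of a weak derivative extends to all smooth test functions that are
square integrable together with their derivative. -/
theorem IsWeakPartial.integral_eq {j : Fin 3} {f g : L2} (h : IsWeakPartial j f g) {ψ : E3 → ℝ}
    (hψ : ContDiff ℝ ∞ ψ) (h2 : MemLp ψ 2 volume)
    (h2' : MemLp (fun x => fderiv ℝ ψ x (basisVec j)) 2 volume) :
    ∫ x, (fderiv ℝ ψ x (basisVec j)) • (f : E3 → E3) x = -∫ x, ψ x • (g : E3 → E3) x := by
  -- Cut `ψ` off by `b(x / (n + 1))`. The derivative of the cutoff is `O(1 / (n + 1))`, so in the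
  -- limit only the derivative of `ψ` survives, by dominated convergence.
  let b : ContDiffBump (0 : E3) := ⟨1, 2, one_pos, one_lt_two⟩
  have hb : ContDiff ℝ ∞ b := b.contDiff
  obtain ⟨C, hC⟩ : ∃ C, ∀ x, ‖fderiv ℝ b x‖ ≤ C :=
    (b.hasCompactSupport.fderiv ℝ).exists_bound_of_continuous (hb.continuous_fderiv (by simp))
  let a : ℕ → ℝ := fun n => ((n : ℝ) + 1)⁻¹
  have ha0 : ∀ n, 0 < a n := fun n => by positivity
  have ha1 : ∀ n, a n ≤ 1 := fun n => inv_le_one_of_one_le₀ (by linarith [n.cast_nonneg (α := ℝ)])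
  have halim : Tendsto a atTop (𝓝 0) := tendsto_inv_atTop_zero.comp
    (tendsto_atTop_add_const_right _ _ tendsto_natCast_atTop_atTop)
  have hχ : ∀ n, ContDiff ℝ ∞ (fun x : E3 => b (a n • x)) := fun n =>
    hb.comp (contDiff_id.const_smul (a n))
  have hχd : ∀ n x, fderiv ℝ (fun x : E3 => b (a n • x)) x (basisVec j) =
      a n * fderiv ℝ b (a n • x) (basisVec j) := fun n x => by
    have h1 : HasFDerivAt (fun x : E3 => a n • x) (a n • ContinuousLinearMap.id ℝ E3) x :=
      (hasFDerivAt_id x).const_smul (a n)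
    have h2 := ((hb.differentiable (by simp)) (a n • x)).hasFDerivAt.comp x h1
    have h3 : fderiv ℝ (fun x : E3 => b (a n • x)) x = _ := h2.fderiv
    rw [h3]
    simp
  have hχt : ∀ x : E3, Tendsto (fun n => b (a n • x)) atTop (𝓝 1) := fun x => by
    have h1 : Tendsto (fun n => a n • x) atTop (𝓝 0) := by
      simpa using halim.smul_const x
    have h2 := (hb.continuous.tendsto 0).comp h1
    have h3 : b (0 : E3) = 1 := b.one_of_mem_closedBall (by simp [b])
    rwa [h3] at h2
  have hb1 : ∀ x, ‖b x‖ ≤ 1 := fun x => by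
    rw [Real.norm_of_nonneg b.nonneg]; exact b.le_one
  have hnorm : ‖basisVec j‖ = 1 := by simp [basisVec]
  have hprod : ∀ n x, fderiv ℝ (fun x => b (a n • x) * ψ x) x (basisVec j) =
      b (a n • x) * fderiv ℝ ψ x (basisVec j) +
        ψ x * (a n * fderiv ℝ b (a n • x) (basisVec j)) := fun n x => by
    rw [fderiv_fun_mul ((hχ n).differentiable (by simp) x) (hψ.differentiable (by simp) x)]
    simp [hχd]
  have key : ∀ n, ∫ x, (fderiv ℝ (fun x => b (a n • x) * ψ x) x (basisVec j)) •
      (f : E3 → E3) x = -∫ x, (b (a n • x) * ψ x) • (g : E3 → E3) x := fun n => by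
    refine h _ ((hχ n).mul hψ) ?_
    refine HasCompactSupport.mul_right ?_
    exact b.hasCompactSupport.comp_homeomorph
      (Homeomorph.smulOfNeZero (α := E3) (a n) (ha0 n).ne')
  have hint1 := integrable_smul_of_memLp_two h2' (Lp.memLp f)
  have hint2 := integrable_smul_of_memLp_two h2 (Lp.memLp f)
  have hint3 := integrable_smul_of_memLp_two h2 (Lp.memLp g)
  have L1 : Tendsto (fun n => ∫ x, (fderiv ℝ (fun x => b (a n • x) * ψ x) x (basisVec j)) •
      (f : E3 → E3) x) atTop (𝓝 (∫ x, (fderiv ℝ ψ x (basisVec j)) • (f : E3 → E3) x)) := by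
    refine tendsto_integral_of_dominated_convergence
      (fun x => ‖(fderiv ℝ ψ x (basisVec j)) • (f : E3 → E3) x‖ + C * ‖ψ x • (f : E3 → E3) x‖)
      (fun n => ?_) (hint1.norm.add (hint2.norm.const_mul C)) (fun n => ?_) ?_
    · have h1 : ContDiff ℝ ∞ (fun x => b (a n • x) * ψ x) := (hχ n).mul hψ
      have h2 : Continuous fun x => fderiv ℝ (fun x => b (a n • x) * ψ x) x (basisVec j) :=
        (h1.continuous_fderiv (by simp)).clm_apply continuous_const
      exact h2.aestronglyMeasurable.smul (Lp.aestronglyMeasurable f)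
    · refine ae_of_all _ fun x => ?_
      rw [hprod, add_smul]
      refine (norm_add_le _ _).trans (add_le_add ?_ ?_)
      · rw [mul_smul, norm_smul]
        exact mul_le_of_le_one_left (norm_nonneg _) (hb1 _)
      · rw [mul_comm (ψ x), mul_smul, norm_smul]
        refine mul_le_mul_of_nonneg_right ?_ (norm_nonneg _)
        rw [norm_mul, Real.norm_of_nonneg (ha0 n).le]
        have := (fderiv ℝ b (a n • x)).le_opNorm (basisVec j)
        rw [hnorm, mul_one] at this
        calc _ ≤ 1 * ‖(fderiv ℝ b (a n • x)) (basisVec j)‖ :=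
              mul_le_mul_of_nonneg_right (ha1 n) (norm_nonneg _)
          _ ≤ C := by rw [one_mul]; exact this.trans (hC _)
    · refine ae_of_all _ fun x => ?_
      refine Tendsto.smul_const ?_ _
      simp_rw [hprod]
      have t1 := (hχt x).mul_const (fderiv ℝ ψ x (basisVec j))
      have t2 : Tendsto (fun n => a n * fderiv ℝ b (a n • x) (basisVec j)) atTop (𝓝 0) := by
        refine squeeze_zero_norm (a := fun n => a n * C) (fun n => ?_) (by simpa using halim.mul_const C)
        rw [norm_mul, Real.norm_of_nonneg (ha0 n).le]
        have := (fderiv ℝ b (a n • x)).le_opNorm (basisVec j)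
        rw [hnorm, mul_one] at this
        exact mul_le_mul_of_nonneg_left (this.trans (hC _)) (ha0 n).le
      simpa using t1.add (t2.const_mul (ψ x))
  have L2' : Tendsto (fun n => -∫ x, (b (a n • x) * ψ x) • (g : E3 → E3) x) atTop
      (𝓝 (-∫ x, ψ x • (g : E3 → E3) x)) := by
    refine Tendsto.neg (tendsto_integral_of_dominated_convergence
      (fun x => ‖ψ x • (g : E3 → E3) x‖)
      (fun n => ?_) hint3.norm (fun n => ?_) ?_)
    · exact (((hχ n).continuous.mul hψ.continuous).aestronglyMeasurable).smul
        (Lp.aestronglyMeasurable g)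
    · refine ae_of_all _ fun x => ?_
      rw [mul_smul, norm_smul]
      exact mul_le_of_le_one_left (norm_nonneg _) (hb1 _)
    · refine ae_of_all _ fun x => ?_
      refine Tendsto.smul_const ?_ _
      simpa using (hχt x).mul_const (ψ x)
  simp_rw [key] at L1
  exact tendsto_nhds_unique L1 L2'

open LineDeriv in
/-- The defining identity of a weak derivative for complex Schwartz functions. -/
theorem IsWeakPartial.integral_schwartz {j : Fin 3} {f g : L2} (h : IsWeakPartial j f g)
    (φ : 𝓢(E3, ℂ)) :
    ∫ x, (∂_{basisVec j} φ : 𝓢(E3, ℂ)) x • toC3.compLp f x = -∫ x, φ x • toC3.compLp g x := by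
  have hφ : ContDiff ℝ ∞ φ := φ.smooth'
  have hd : ∀ x, HasFDerivAt φ (fderiv ℝ φ x) x := fun x => φ.hasFDerivAt x
  have hred : ∀ x, HasFDerivAt (fun x => (φ x).re) (Complex.reCLM ∘L fderiv ℝ φ x) x := fun x =>
    Complex.reCLM.hasFDerivAt.comp x (hd x)
  have himd : ∀ x, HasFDerivAt (fun x => (φ x).im) (Complex.imCLM ∘L fderiv ℝ φ x) x := fun x =>
    Complex.imCLM.hasFDerivAt.comp x (hd x)
  have m1 : MemLp φ 2 volume := φ.memLp 2
  have m2 : MemLp (fun x => fderiv ℝ φ x (basisVec j)) 2 volume :=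
    (∂_{basisVec j} φ : 𝓢(E3, ℂ)).memLp 2 volume
  have e1 := h.integral_eq (ψ := fun x => (φ x).re) (Complex.reCLM.contDiff.comp hφ) m1.re
    (by simp_rw [fun x => (hred x).fderiv]; exact m2.re)
  have e2 := h.integral_eq (ψ := fun x => (φ x).im) (Complex.imCLM.contDiff.comp hφ) m1.im
    (by simp_rw [fun x => (himd x).fderiv]; exact m2.im)
  simp_rw [fun x => (hred x).fderiv] at e1
  simp_rw [fun x => (himd x).fderiv] at e2
  -- The field `k` is real, so a complex test function acts through its real and imaginary parts, to
  -- which the real identity applies.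
  have split : ∀ (χ : E3 → ℂ) (k : L2), MemLp χ 2 volume →
      ∫ x, χ x • toC3.compLp k x = toC3 (∫ x, (χ x).re • (k : E3 → E3) x) +
        Complex.I • toC3 (∫ x, (χ x).im • (k : E3 → E3) x) := by
    intro χ k hχ
    have i1 : Integrable fun x => (χ x).re • (k : E3 → E3) x :=
      integrable_smul_of_memLp_two hχ.re (Lp.memLp k)
    have i2 : Integrable fun x => (χ x).im • (k : E3 → E3) x :=
      integrable_smul_of_memLp_two hχ.im (Lp.memLp k)
    have i3 : Integrable fun x => Complex.I • toC3 ((χ x).im • (k : E3 → E3) x) :=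
      (toC3.integrable_comp i2).smul Complex.I
    rw [← toC3.integral_comp_comm i1, ← toC3.integral_comp_comm i2, ← integral_smul,
      ← integral_add (toC3.integrable_comp i1) i3]
    refine integral_congr_ae ?_
    filter_upwards [toC3.coeFn_compLp k] with x hx
    rw [hx]
    ext i
    simp only [PiLp.smul_apply, PiLp.add_apply, toC3_apply, smul_eq_mul, Complex.ofReal_mul]
    conv_lhs => rw [← Complex.re_add_im (χ x)]
    ring
  rw [split _ g m1]
  have e0 := split _ f m2
  refine e0.trans ?_
  simp only [ContinuousLinearMap.comp_apply, Complex.reCLM_apply, Complex.imCLM_apply] at e1 e2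
  rw [e1, e2]
  simp [add_comm]

open LineDeriv in
/-- A weak partial derivative is the Fourier multiplier `2πiξⱼ`. -/
theorem IsWeakPartial.fourierL2_ae_eq {j : Fin 3} {f g : L2} (h : IsWeakPartial j f g) :
    fourierL2 g =ᵐ[volume] fun ξ => (2 * Real.pi * Complex.I * (ξ j : ℂ)) • fourierL2 f ξ := by
  refine fourier_ae_eq_of_pairing (toC3.compLp g) ?_ fun φ _ => ?_
  · exact ((Lp.memLp (fourierL2 f)).locallyIntegrable (by norm_num)).continuous_smul
      (by fun_prop)
  · have h1 := h.integral_schwartz (𝓕 φ)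
    rw [SchwartzMap.lineDerivOp_fourier_eq] at h1
    have h2 := integral_schwartz_smul_fourier (toC3.compLp f)
      (-(2 * Real.pi * Complex.I) • smulLeftCLM ℂ (inner ℝ · (basisVec j)) φ)
    rw [← h2] at h1
    rw [← neg_eq_iff_eq_neg.2 h1, ← integral_neg]
    refine integral_congr_ae (ae_of_all _ fun x => ?_)
    have ht : (fun x : E3 => inner ℝ x (basisVec j)).HasTemperateGrowth :=
      ((innerSL ℝ).flip (basisVec j)).hasTemperateGrowth
    have hx : inner ℝ x (basisVec j) = x j := by simp [basisVec, EuclideanSpace.inner_single_right]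
    simp only [smul_apply, SchwartzMap.smulLeftCLM_apply_apply ht, hx, ← fourierL2_apply]
    rw [smul_smul, ← neg_smul]
    congr 1
    simp
    ring

/-- The weak Laplacian is the Fourier multiplier `-(2π|ξ|)²`. -/
theorem IsWeakLaplacian.fourierL2_ae_eq {u L : L2} (h : IsWeakLaplacian u L) :
    fourierL2 L =ᵐ[volume] fun ξ => (-(2 * Real.pi * ‖ξ‖) ^ 2 : ℝ) • fourierL2 u ξ := by
  obtain ⟨G, K, hG, hK, rfl⟩ := h
  have hsum : fourierL2 (∑ i, K i i) =ᵐ[volume] fun ξ => ∑ i, fourierL2 (K i i) ξ := by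
    rw [map_sum]
    exact Lp.coeFn_finsetSum _ _
  have h1 : ∀ᵐ ξ, ∀ i, fourierL2 (G i) ξ =
      (2 * Real.pi * Complex.I * (ξ i : ℂ)) • fourierL2 u ξ :=
    ae_all_iff.2 fun i => (hG i).fourierL2_ae_eq
  have h2 : ∀ᵐ ξ, ∀ i, fourierL2 (K i i) ξ =
      (2 * Real.pi * Complex.I * (ξ i : ℂ)) • fourierL2 (G i) ξ :=
    ae_all_iff.2 fun i => (hK i i).fourierL2_ae_eq
  filter_upwards [hsum, h1, h2] with ξ e0 e1 e2
  rw [e0]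
  simp_rw [e2, e1, smul_smul]
  rw [← Finset.sum_smul, ← Complex.coe_smul]
  congr 1
  rw [mul_pow, EuclideanSpace.norm_sq_eq]
  simp only [Fin.sum_univ_three, Real.norm_eq_abs, sq_abs]
  have hI : Complex.I ^ 2 = -1 := Complex.I_sq
  push_cast
  linear_combination (4 * Real.pi ^ 2 * ((ξ 0 : ℂ) ^ 2 + (ξ 1 : ℂ) ^ 2 + (ξ 2 : ℂ) ^ 2)) * hI

/-- The Sobolev embedding `H² ⊂ L^∞` in dimension three. -/
theorem IsWeakLaplacian.ae_bounded {u L : L2} (h : IsWeakLaplacian u L) :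
    ∃ C : ℝ, ∀ᵐ x, ‖(u : E3 → E3) x‖ ≤ C := by
  -- Write `û = (1 + |ξ|²)⁻¹ · (û - (4π²)⁻¹ L̂)`, the bracket being `(1 + |ξ|²) û`. Both factors are
  -- in `L²`, the first because `(1 + |ξ|²)⁻²` is integrable on `ℝ³` (`4 > 3`).
  have hint : Integrable (fourierL2 u) := by
    have hw : MemLp (fun ξ : E3 => (1 + ‖ξ‖ ^ 2)⁻¹) 2 volume := by
      rw [memLp_two_iff_integrable_sq (by fun_prop)]
      have := integrable_rpow_neg_one_add_norm_sq (E := E3) (μ := volume) (r := 4)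
        (by simp; norm_num)
      refine this.congr (ae_of_all _ fun ξ => ?_)
      have h0 : 0 < 1 + ‖ξ‖ ^ 2 := by positivity
      simp only
      rw [show (-4 / 2 : ℝ) = ((-2 : ℤ) : ℝ) by norm_num, Real.rpow_intCast, inv_pow]
      rfl
    have hv : MemLp (fun ξ => fourierL2 u ξ - ((4 * Real.pi ^ 2)⁻¹ : ℝ) • fourierL2 L ξ) 2 volume :=
      (Lp.memLp (fourierL2 u)).sub ((Lp.memLp (fourierL2 L)).const_smul ((4 * Real.pi ^ 2)⁻¹ : ℝ))
    refine (integrable_smul_of_memLp_two hw hv).congr ?_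
    filter_upwards [h.fourierL2_ae_eq] with ξ hξ
    rw [hξ, smul_smul, ← one_smul ℝ (fourierL2 u ξ), smul_smul, ← sub_smul, smul_smul]
    congr 1
    have h0 : 1 + ‖ξ‖ ^ 2 ≠ 0 := by positivity
    have hpi := Real.pi_ne_zero
    field_simp
    ring
  refine ⟨∫ ξ, ‖fourierL2 u ξ‖, ?_⟩
  filter_upwards [ae_norm_le_of_integrable_fourier _ hint, toC3.coeFn_compLp u] with x hx h2
  rw [h2, norm_toC3] at hx
  exact hx

end WeakDerivative

/-! ### Translations, and their action on solenoidal fields -/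

section Translation

/-- Translation by `y` on `L²`. -/
def translate {F : Type*} [NormedAddCommGroup F] (y : E3) (f : Lp F 2 (volume : Measure E3)) :
    Lp F 2 (volume : Measure E3) :=
  Lp.compMeasurePreserving (fun x => x + y) (measurePreserving_add_right volume y) f

theorem coeFn_translate {F : Type*} [NormedAddCommGroup F] (y : E3)
    (f : Lp F 2 (volume : Measure E3)) :
    translate y f =ᵐ[volume] fun x => f (x + y) :=
  Lp.coeFn_compMeasurePreserving f _

/-- The Fourier transform turns translations into modulations. -/
theorem fourierL2_translate (y : E3) (f : L2) :
    fourierL2 (translate y f) =ᵐ[volume]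
      fun ξ => (Real.fourierChar (inner ℝ ξ y) : ℂ) • fourierL2 f ξ := by
  have hc : ContDiff ℝ ∞ fun ξ : E3 => (Real.fourierChar (inner ℝ ξ y) : ℂ) := by
    simp_rw [Real.fourierChar_apply]
    have h1 : ContDiff ℝ ∞ fun ξ : E3 => inner ℝ ξ y := contDiff_id.inner ℝ contDiff_const
    exact ((Complex.ofRealCLM.contDiff.comp (contDiff_const.mul h1)).mul contDiff_const).cexp
  refine fourier_ae_eq_of_pairing _ ?_ fun φ hφ => ?_
  · exact ((Lp.memLp (fourierL2 f)).locallyIntegrable (by norm_num)).continuous_smul hc.continuous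
  · let ψ : 𝓢(E3, ℂ) := HasCompactSupport.toSchwartzMap
      (f := fun ξ => (Real.fourierChar (inner ℝ ξ y) : ℂ) * φ ξ) hφ.mul_left
      (hc.mul φ.smooth')
    have hψ : ∀ ξ, ψ ξ = (Real.fourierChar (inner ℝ ξ y) : ℂ) * φ ξ := fun _ => rfl
    have e1 := integral_schwartz_smul_fourier (toC3.compLp f) ψ
    have e2 : ∀ x, (𝓕 ψ) x = (𝓕 φ) (x - y) := fun x => by
      rw [SchwartzMap.fourier_coe, SchwartzMap.fourier_coe, Real.fourier_eq, Real.fourier_eq]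
      refine integral_congr_ae (ae_of_all _ fun ξ => ?_)
      simp only [hψ, Circle.smul_def, smul_eq_mul]
      rw [← mul_assoc, ← Circle.coe_mul, ← AddChar.map_add_eq_mul, inner_sub_right]
      congr 4
      ring
    have e3 : ∫ x, (𝓕 φ) x • toC3.compLp (translate y f) x =
        ∫ x, (𝓕 ψ) x • toC3.compLp f x := by
      simp_rw [e2]
      refine Eq.trans (integral_congr_ae ?_)
        (integral_add_right_eq_self (fun x => (𝓕 φ) (x - y) • toC3.compLp f x) y)
      have h1 := (measurePreserving_add_right volume y).quasiMeasurePreserving.ae_eq_comp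
        (toC3.coeFn_compLp' f)
      filter_upwards [toC3.coeFn_compLp (translate y f), coeFn_translate y f, h1] with x a1 a2 a3
      simp only [Function.comp_apply] at a3
      rw [a1, a2, add_sub_cancel_right, a3]
    rw [e3, ← e1]
    refine integral_congr_ae (ae_of_all _ fun ξ => ?_)
    simp only [hψ, ← fourierL2_apply, smul_smul, mul_comm]

theorem divergence_comp_add_right (φ : E3 → E3) (y x : E3) :
    divergence (fun x => φ (x + y)) x = divergence φ (x + y) := by
  simp only [divergence, fderiv_comp_add_right]

/-- The translations map the solenoidal fields into themselves. -/
theorem translate_mem_H (y : E3) {g : L2} (hg : g ∈ H) : translate y g ∈ H := by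
  let T : L2 →ₗᵢ[ℝ] L2 := Lp.compMeasurePreservingₗᵢ ℝ (fun x => x + y)
    (measurePreserving_add_right volume y)
  have hT : ∀ f ∈ Submodule.span ℝ solenoidalTest, T f ∈ Submodule.span ℝ solenoidalTest := by
    intro f hf
    induction hf using Submodule.span_induction with
    | mem f hf =>
      obtain ⟨φ, h1, h2, h3, h4⟩ := hf
      refine Submodule.subset_span ⟨fun x => φ (x + y), h1.comp (contDiff_id.add contDiff_const),
        h2.comp_homeomorph (Homeomorph.addRight y), fun x => ?_, ?_⟩
      · rw [divergence_comp_add_right, h3]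
      · have h5 := (measurePreserving_add_right volume y).quasiMeasurePreserving.ae_eq_comp h4
        exact (coeFn_translate y f).trans h5
    | zero => rw [map_zero]; exact Submodule.zero_mem _
    | add f g _ _ hf hg => rw [map_add]; exact Submodule.add_mem _ hf hg
    | smul a f _ hf => rw [map_smul]; exact Submodule.smul_mem _ _ hf
  exact map_mem_closure T.continuous hg hT

end Translation

/-! ### The Leray projection, frequency by frequency -/

section Leray

/-- The Leray projection of a field has the same Fourier coefficients against solenoidal fields
as the field itself, frequency by frequency. -/
theorem inner_fourierL2_leray (f : L2) (g : H) :
    ∀ᵐ ξ, (inner ℂ (fourierL2 (leray f : L2) ξ) (fourierL2 (g : L2) ξ) : ℂ) =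
      inner ℂ (fourierL2 f ξ) (fourierL2 (g : L2) ξ) := by
  set d : L2 := (leray f : L2) - f with hd
  have horth : ∀ k ∈ H, inner ℝ d k = 0 := fun k hk => by
    have := H.starProjection_inner_eq_zero f k hk
    rw [hd, ← neg_sub, inner_neg_left, neg_eq_zero]
    exact this
  -- The Fourier integral at `y` of this product is, by Parseval, the inner product of `d` with a
  -- translate of `g`. That translate is again solenoidal, so the integral vanishes for every `y`,
  -- and hence so does the product.
  have hq0 : (fun ξ => (inner ℂ (fourierL2 d ξ) (fourierL2 (g : L2) ξ) : ℂ)) =ᵐ[volume] 0 := by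
    refine ae_eq_zero_of_fourier_eq_zero (integrable_inner_fourierL2 d g) fun y => ?_
    have h1 := integral_inner_fourierL2 d (translate (-y) (g : L2))
    rw [horth _ (translate_mem_H _ g.2), Complex.ofReal_zero] at h1
    rw [Real.fourier_eq, ← h1]
    refine integral_congr_ae ?_
    filter_upwards [fourierL2_translate (-y) (g : L2)] with ξ hξ
    rw [hξ, inner_smul_right, inner_neg_right]
    rfl
  have hsub : fourierL2 d =ᵐ[volume] fun ξ => fourierL2 (leray f : L2) ξ - fourierL2 f ξ := by
    rw [hd, map_sub]
    exact Lp.coeFn_sub _ _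
  filter_upwards [hq0, hsub] with ξ h1 h2
  rw [h2, inner_sub_left] at h1
  exact sub_eq_zero.1 h1

end Leray

/-! ### The convection term on the Fourier side -/

section Convection

/-- The product of the `i`-th component of a square integrable field with another square
integrable field. -/
def compSmul (i : Fin 3) (u k : L2) (x : E3) : C3 := toC3 (((u : E3 → E3) x i) • (k : E3 → E3) x)

theorem memLp_component (i : Fin 3) (u : L2) :
    MemLp (fun x => (u : E3 → E3) x i) 2 volume :=
  (EuclideanSpace.proj (𝕜 := ℝ) i).comp_memLp' (Lp.memLp u)

theorem integrable_compSmul (i : Fin 3) (u k : L2) : Integrable (compSmul i u k) :=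
  toC3.integrable_comp (integrable_smul_of_memLp_two (memLp_component i u) (Lp.memLp k))

theorem integral_norm_compSmul_le (i : Fin 3) (u k : L2) :
    ∫ x, ‖compSmul i u k x‖ ≤ ‖u‖ * ‖k‖ := by
  have h1 : ∫ x, ‖compSmul i u k x‖ =
      (eLpNorm (fun x => ((u : E3 → E3) x i) • (k : E3 → E3) x) 1 volume).toReal := by
    have hi := integrable_smul_of_memLp_two (memLp_component i u) (Lp.memLp k)
    rw [eLpNorm_one_eq_lintegral_enorm, ← integral_norm_eq_lintegral_enorm hi.1]
    simp only [compSmul, norm_toC3]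
  have h2 : eLpNorm (fun x => ((u : E3 → E3) x i) • (k : E3 → E3) x) 1 volume ≤
      eLpNorm u 2 volume * eLpNorm k 2 volume := by
    refine (eLpNorm_smul_le_mul_eLpNorm (p := 2) (q := 2) (Lp.aestronglyMeasurable k)
      (memLp_component i u).1).trans ?_
    have h3 : eLpNorm (fun x => (u : E3 → E3) x i) 2 volume ≤ eLpNorm u 2 volume :=
      eLpNorm_mono fun x => PiLp.norm_apply_le _ i
    exact mul_le_mul_left h3 _
  rw [h1, Lp.norm_def, Lp.norm_def, ← ENNReal.toReal_mul]
  exact ENNReal.toReal_mono (ENNReal.mul_ne_top (Lp.eLpNorm_ne_top u) (Lp.eLpNorm_ne_top k)) h2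

/-- The Fourier integral of `uᵢ k`. -/
def fourierProd (i : Fin 3) (u k : L2) (ξ : E3) : C3 := (𝓕 (compSmul i u k)) ξ

theorem continuous_fourierProd (i : Fin 3) (u k : L2) : Continuous (fourierProd i u k) :=
  continuous_fourier_of_integrable (integrable_compSmul i u k)

/-- The Fourier transform maps `L¹` to bounded functions, and the product of two `L²` functions is
in `L¹`. This is the source of the `L²` norms of `u` and `v` in the theorem. -/
theorem norm_fourierProd_le (i : Fin 3) (u k : L2) (ξ : E3) :
    ‖fourierProd i u k ξ‖ ≤ ‖u‖ * ‖k‖ :=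
  (VectorFourier.norm_fourierIntegral_le_integral_norm _ _ _ _ _).trans
    (integral_norm_compSmul_le i u k)

theorem fourierProd_add_left (i : Fin 3) (u u' k : L2) (ξ : E3) :
    fourierProd i (u + u') k ξ = fourierProd i u k ξ + fourierProd i u' k ξ := by
  have h : compSmul i (u + u') k =ᵐ[volume] compSmul i u k + compSmul i u' k := by
    filter_upwards [Lp.coeFn_add u u'] with x hx
    rw [Pi.add_apply] at hx
    simp only [compSmul, hx, Pi.add_apply, PiLp.add_apply, add_smul, map_add]
  rw [fourierProd, Real.fourier_congr_ae h]
  exact congrFun (VectorFourier.fourierIntegral_add Real.continuous_fourierChar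
    continuous_inner (integrable_compSmul i u k) (integrable_compSmul i u' k)) ξ

theorem fourierProd_add_right (i : Fin 3) (u k k' : L2) (ξ : E3) :
    fourierProd i u (k + k') ξ = fourierProd i u k ξ + fourierProd i u k' ξ := by
  have h : compSmul i u (k + k') =ᵐ[volume] compSmul i u k + compSmul i u k' := by
    filter_upwards [Lp.coeFn_add k k'] with x hx
    rw [Pi.add_apply] at hx
    simp only [compSmul, hx, Pi.add_apply, smul_add, map_add]
  rw [fourierProd, Real.fourier_congr_ae h]
  exact congrFun (VectorFourier.fourierIntegral_add Real.continuous_fourierChar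
    continuous_inner (integrable_compSmul i u k) (integrable_compSmul i u k')) ξ

theorem fourierProd_smul_left (i : Fin 3) (a : ℝ) (u k : L2) (ξ : E3) :
    fourierProd i (a • u) k ξ = a • fourierProd i u k ξ := by
  have h : compSmul i (a • u) k =ᵐ[volume] (a : ℂ) • compSmul i u k := by
    filter_upwards [Lp.coeFn_smul a u] with x hx
    rw [Pi.smul_apply] at hx
    simp only [compSmul, hx, Pi.smul_apply, PiLp.smul_apply, smul_eq_mul, mul_smul, map_smul,
      Complex.coe_smul]
  rw [fourierProd, Real.fourier_congr_ae h, ← Complex.coe_smul]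
  exact congrFun (VectorFourier.fourierIntegral_const_smul _ _ _ _ _) ξ

theorem fourierProd_smul_right (i : Fin 3) (a : ℝ) (u k : L2) (ξ : E3) :
    fourierProd i u (a • k) ξ = a • fourierProd i u k ξ := by
  have h : compSmul i u (a • k) =ᵐ[volume] (a : ℂ) • compSmul i u k := by
    filter_upwards [Lp.coeFn_smul a k] with x hx
    rw [Pi.smul_apply] at hx
    simp only [compSmul, hx, Pi.smul_apply, map_smul, Complex.coe_smul, smul_comm a]
  rw [fourierProd, Real.fourier_congr_ae h, ← Complex.coe_smul]
  exact congrFun (VectorFourier.fourierIntegral_const_smul _ _ _ _ _) ξ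

/-- `u ↦ 𝓕(uᵢ k)(ξ)` as a continuous linear map. -/
def fourierProdL (i : Fin 3) (k : L2) (ξ : E3) : L2 →L[ℝ] C3 :=
  LinearMap.mkContinuous
    { toFun := fun u => fourierProd i u k ξ
      map_add' := fun u u' => fourierProd_add_left i u u' k ξ
      map_smul' := fun a u => fourierProd_smul_left i a u k ξ }
    ‖k‖ (fun u => (norm_fourierProd_le i u k ξ).trans_eq (mul_comm _ _))

theorem fourierProdL_apply (i : Fin 3) (k : L2) (ξ : E3) (u : L2) :
    fourierProdL i k ξ u = fourierProd i u k ξ := rfl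

/-- The Fourier transform of `(u · ∇)v = ∑ᵢ ∂ᵢ(uᵢ v)` for solenoidal `u`. -/
def fourierConv (u v : L2) (ξ : E3) : C3 :=
  ∑ i, (2 * Real.pi * Complex.I * (ξ i : ℂ)) • fourierProd i u v ξ

open LineDeriv in
-- For fixed `ξ` the product of the character `e` with `φᵢ` is a test function, so the weak
-- derivative of `v` can be moved onto it. Then `∂ᵢ(e φᵢ) = e ∂ᵢφᵢ - 2πiξᵢ e φᵢ`, and the first
-- terms add up to `e div φ = 0`.
theorem sum_fourierProd_of_test {v : L2} {G : Fin 3 → L2} (hG : ∀ i, IsWeakPartial i v (G i))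
    {u : L2} (hu : u ∈ solenoidalTest) (ξ : E3) :
    ∑ i, fourierProd i u (G i) ξ = fourierConv u v ξ := by
  obtain ⟨φ, hφ, hφc, hdiv, hae⟩ := hu
  let e : E3 → ℂ := fun x => (Real.fourierChar (-inner ℝ x ξ) : ℂ)
  have he : ContDiff ℝ ∞ e := by
    simp only [e, Real.fourierChar_apply]
    have h1 : ContDiff ℝ ∞ fun x : E3 => -inner ℝ x ξ := (contDiff_id.inner ℝ contDiff_const).neg
    exact ((Complex.ofRealCLM.contDiff.comp (contDiff_const.mul h1)).mul contDiff_const).cexp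
  have hed : ∀ x i, fderiv ℝ e x (basisVec i) = -(2 * Real.pi * Complex.I * (ξ i : ℂ)) * e x := by
    intro x i
    have h1 := Real.fderiv_fourierChar_neg_bilinear_right_apply ((innerSL ℝ).flip) ξ x (basisVec i)
    have h3 : (innerSL ℝ).flip ξ (basisVec i) = ξ i := by
      change inner ℝ (basisVec i) ξ = ξ i
      simp [basisVec, EuclideanSpace.inner_single_left]
    rw [h3] at h1
    refine Eq.trans h1 ?_
    simp only [e]
    rw [show (innerSL ℝ).flip ξ x = inner ℝ x ξ from rfl]
    ring
  have hφi : ∀ i, ContDiff ℝ ∞ fun x => (φ x i : ℂ) := fun i =>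
    Complex.ofRealCLM.contDiff.comp ((EuclideanSpace.proj (𝕜 := ℝ) i).contDiff.comp hφ)
  have hφic : ∀ i, HasCompactSupport fun x => (φ x i : ℂ) := fun i =>
    hφc.comp_left (g := fun y : E3 => ((y i : ℝ) : ℂ)) (by simp)
  have hφid : ∀ x i, fderiv ℝ (fun x => (φ x i : ℂ)) x (basisVec i) =
      ((fderiv ℝ φ x (basisVec i) i : ℝ) : ℂ) := by
    intro x i
    have h1 := (Complex.ofRealCLM.hasFDerivAt (x := φ x i)).comp x
      ((EuclideanSpace.proj (𝕜 := ℝ) i).hasFDerivAt.comp x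
        (hφ.differentiable (by simp) x).hasFDerivAt)
    have h2 : fderiv ℝ (fun x => (φ x i : ℂ)) x = _ := h1.fderiv
    rw [h2]
    simp
  let ψ : Fin 3 → 𝓢(E3, ℂ) := fun i => HasCompactSupport.toSchwartzMap
    (f := fun x => e x * (φ x i : ℂ)) (hφic i).mul_left (he.mul (hφi i))
  have hψ : ∀ i x, ψ i x = e x * (φ x i : ℂ) := fun _ _ => rfl
  have hψd : ∀ i x, (∂_{basisVec i} (ψ i) : 𝓢(E3, ℂ)) x =
      e x * ((fderiv ℝ φ x (basisVec i) i : ℝ) : ℂ) -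
        (2 * Real.pi * Complex.I * (ξ i : ℂ)) * (e x * (φ x i : ℂ)) := by
    intro i x
    rw [SchwartzMap.lineDerivOp_apply_eq_fderiv]
    change fderiv ℝ (fun x => e x * (φ x i : ℂ)) x (basisVec i) = _
    rw [fderiv_fun_mul (he.differentiable (by simp) x) ((hφi i).differentiable (by simp) x)]
    simp only [add_apply, smul_apply, hφid, hed,
      smul_eq_mul]
    ring
  have hprod : ∀ i (k : L2), fourierProd i u k ξ = ∫ x, ψ i x • toC3.compLp k x := by
    intro i k
    rw [fourierProd, Real.fourier_eq]
    refine integral_congr_ae ?_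
    filter_upwards [toC3.coeFn_compLp k, hae] with x h1 h2
    simp only [compSmul, h1, h2, hψ, e, map_smul, Circle.smul_def, mul_smul, Complex.coe_smul]
  have hint : ∀ i, Integrable fun x => (∂_{basisVec i} (ψ i) : 𝓢(E3, ℂ)) x • toC3.compLp v x :=
    fun i => integrable_smul_of_memLp_two (SchwartzMap.memLp _ 2 volume) (Lp.memLp _)
  have hint' : ∀ i, Integrable fun x => (2 * Real.pi * Complex.I * (ξ i : ℂ)) •
      (ψ i x • toC3.compLp v x) := fun i =>
    (integrable_smul_of_memLp_two ((ψ i).memLp 2 volume) (Lp.memLp _)).smul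
      (2 * Real.pi * Complex.I * (ξ i : ℂ))
  simp only [fourierConv, hprod]
  simp_rw [fun i => neg_eq_iff_eq_neg.2 ((hG i).integral_schwartz (ψ i)) |>.symm,
    ← integral_smul]
  rw [← integral_finsetSum _ fun i _ => hint' i, Finset.sum_neg_distrib,
    ← integral_finsetSum _ fun i _ => hint i, ← integral_neg]
  refine integral_congr_ae (ae_of_all _ fun x => ?_)
  have hx : (∑ i, ((fderiv ℝ φ x (basisVec i) i : ℝ) : ℂ)) = 0 := by
    have := hdiv x
    rw [divergence] at this
    exact_mod_cast this
  simp only [smul_smul, ← Finset.sum_smul, ← neg_smul]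
  congr 1
  simp_rw [hψd, hψ]
  rw [Finset.sum_sub_distrib, ← Finset.mul_sum, hx]
  ring

/-- At a fixed frequency both sides are continuous linear in `u`, so their difference has a closed
kernel; it contains the test fields, hence all of `ℍ`. -/
theorem sum_fourierProd_eq {v : L2} {G : Fin 3 → L2} (hG : ∀ i, IsWeakPartial i v (G i))
    {u : L2} (hu : u ∈ H) (ξ : E3) :
    ∑ i, fourierProd i u (G i) ξ = fourierConv u v ξ := by
  let A : L2 →L[ℝ] C3 := ∑ i, fourierProdL i (G i) ξ -
    ∑ i, ((2 * Real.pi * Complex.I * (ξ i : ℂ)) • fourierProdL i v ξ : L2 →L[ℝ] C3)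
  have hA : ∀ k, A k = ∑ i, fourierProd i k (G i) ξ - fourierConv k v ξ := fun k => by
    simp [A, fourierConv, fourierProdL_apply]
  have hle : H ≤ LinearMap.ker (A : L2 →ₗ[ℝ] C3) := by
    refine Submodule.topologicalClosure_minimal _ (Submodule.span_le.2 fun k hk => ?_) ?_
    · exact (hA k).trans (sub_eq_zero.2 (sum_fourierProd_of_test hG hk ξ))
    · exact A.isClosed_ker
  exact sub_eq_zero.1 ((hA u).symm.trans (hle hu))

/-- The Fourier transform of the convection term. -/
theorem fourierL2_convection {u v f : L2} (hu : u ∈ H) {G : Fin 3 → L2}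
    (hG : ∀ i, IsWeakPartial i v (G i))
    (hf : (f : E3 → E3) =ᵐ[volume]
      fun x => ∑ i, ((u : E3 → E3) x i) • (G i : E3 → E3) x) :
    fourierL2 f =ᵐ[volume] fourierConv u v := by
  have h1 : (toC3.compLp f : E3 → C3) =ᵐ[volume] fun x => ∑ i, compSmul i u (G i) x := by
    filter_upwards [toC3.coeFn_compLp f, hf] with x a b
    rw [a, b, map_sum]
    rfl
  have hint : Integrable (toC3.compLp f) :=
    (integrable_finsetSum _ fun i _ => integrable_compSmul i u (G i)).congr h1.symm
  filter_upwards [fourier_ae_eq_fourierIntegral (toC3.compLp f) hint] with ξ hξ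
  rw [fourierL2_apply, hξ, Real.fourier_congr_ae h1, ← sum_fourierProd_eq hG hu, Real.fourier_eq]
  simp_rw [Finset.smul_sum]
  rw [integral_finsetSum]
  · rfl
  · intro i _
    exact (Real.fourierIntegral_convergent_iff ξ).2 (integrable_compSmul i u (G i))

theorem continuous_fourierConv (u v : L2) : Continuous (fourierConv u v) :=
  continuous_finsetSum _ fun i _ => by
    have h : Continuous fun ξ : E3 => (2 * Real.pi * Complex.I * (ξ i : ℂ)) := by fun_prop
    exact h.smul (continuous_fourierProd i u v)

/-- The derivative in divergence form costs one factor `2π|ξ|`; the `3` counts the components of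
`u`. -/
theorem norm_fourierConv_le (u v : L2) (ξ : E3) :
    ‖fourierConv u v ξ‖ ≤ 3 * (2 * Real.pi * ‖ξ‖) * (‖u‖ * ‖v‖) := by
  refine (norm_sum_le_of_le _ (f := fun i => (2 * Real.pi * Complex.I * (ξ i : ℂ)) •
    fourierProd i u v ξ) (n := fun _ => (2 * Real.pi * ‖ξ‖) * (‖u‖ * ‖v‖)) fun i _ => ?_).trans_eq ?_
  · rw [norm_smul]
    refine mul_le_mul ?_ (norm_fourierProd_le i u v ξ) (norm_nonneg _) (by positivity)
    simp only [norm_mul, Complex.norm_I, mul_one, Complex.norm_real, Complex.norm_ofNat,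
      Real.norm_of_nonneg Real.pi_pos.le]
    gcongr
    exact PiLp.norm_apply_le ξ i
  · simp
    ring

theorem fourierConv_add_left (u u' v : L2) (ξ : E3) :
    fourierConv (u + u') v ξ = fourierConv u v ξ + fourierConv u' v ξ := by
  simp [fourierConv, fourierProd_add_left, Finset.sum_add_distrib]

theorem fourierConv_add_right (u v v' : L2) (ξ : E3) :
    fourierConv u (v + v') ξ = fourierConv u v ξ + fourierConv u v' ξ := by
  simp [fourierConv, fourierProd_add_right, Finset.sum_add_distrib]

theorem fourierConv_smul_left (a : ℝ) (u v : L2) (ξ : E3) :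
    fourierConv (a • u) v ξ = a • fourierConv u v ξ := by
  simp only [fourierConv, fourierProd_smul_left, Finset.smul_sum, smul_comm a]

theorem fourierConv_smul_right (a : ℝ) (u v : L2) (ξ : E3) :
    fourierConv u (a • v) ξ = a • fourierConv u v ξ := by
  simp only [fourierConv, fourierProd_smul_right, Finset.smul_sum, smul_comm a]

/-- For `u, v` in the domain of the Stokes operator the convection term exists, and its Fourier
transform pairs with solenoidal fields like `fourierConv u v`. -/
theorem exists_isConvection {u v : H} (hu : u ∈ stokesDomain) (hv : v ∈ stokesDomain) :
    ∃ F : H, IsConvection u v F ∧ ∀ g : H, ∀ᵐ ξ,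
      (inner ℂ (fourierField F ξ) (fourierField g ξ) : ℂ) =
        inner ℂ (fourierConv u v ξ) (fourierField g ξ) := by
  obtain ⟨_, L, hL, _⟩ := hu
  -- Boundedness of `u` is what puts each `uᵢ ∂ᵢv` in `L²`, so that `ℙ` can be applied.
  obtain ⟨C, hC⟩ := hL.ae_bounded
  obtain ⟨_, _, ⟨G, _, hG, _, _⟩, _⟩ := hv
  have hmem : MemLp (fun x => ∑ i, (((u : L2) : E3 → E3) x i) • (G i : E3 → E3) x) 2 volume := by
    refine memLp_finsetSum _ fun i _ => ?_
    refine (Lp.memLp (G i)).of_le_mul (c := C)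
      ((memLp_component i u).1.smul (Lp.aestronglyMeasurable _)) ?_
    filter_upwards [hC] with x hx
    rw [norm_smul]
    exact mul_le_mul_of_nonneg_right ((PiLp.norm_apply_le _ i).trans hx) (norm_nonneg _)
  refine ⟨leray hmem.toLp, ⟨G, hmem.toLp, hG, hmem.coeFn_toLp, rfl⟩, fun g => ?_⟩
  filter_upwards [inner_fourierL2_leray hmem.toLp g,
    fourierL2_convection u.2 hG hmem.coeFn_toLp] with ξ h1 h2
  rw [fourierField_eq, fourierField_eq, h1, h2]

end Convection

/-! ### Lower semicontinuity of weighted integrals -/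

section Fatou

variable {F : Type*} [NormedAddCommGroup F]

/-- Lower semicontinuity of weighted `L²` integrals along `L²` convergence. -/
theorem lintegral_weight_le_of_tendsto {w : ℕ → E3 → ℝ≥0∞} {w' : E3 → ℝ≥0∞} {M : ℕ → ℝ≥0∞}
    {M' : ℝ≥0∞}
    (hw : ∀ n, Measurable (w n)) (hlim : ∀ x, Tendsto (fun n => w n x) atTop (𝓝 (w' x)))
    (hfin : ∀ᵐ x : E3, w' x ≠ ⊤) {h : ℕ → Lp F 2 (volume : Measure E3)}
    {h' : Lp F 2 (volume : Measure E3)} (hh : Tendsto h atTop (𝓝 h'))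
    (hMt : Tendsto M atTop (𝓝 M')) (hM : ∀ n, ∫⁻ x, w n x * ‖h n x‖ₑ ^ 2 ≤ M n) :
    ∫⁻ x, w' x * ‖h' x‖ₑ ^ 2 ≤ M' := by
  obtain ⟨ns, hns, hae⟩ := (tendstoInMeasure_of_tendsto_Lp hh).exists_seq_tendsto_ae
  have hpt : ∀ᵐ x, w' x * ‖h' x‖ₑ ^ 2 =
      liminf (fun n => w (ns n) x * ‖h (ns n) x‖ₑ ^ 2) atTop := by
    filter_upwards [hae, hfin] with x h1 h2
    refine (Tendsto.liminf_eq ?_).symm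
    -- Multiplication in `ℝ≥0∞` is discontinuous at `(∞, 0)`; the finiteness of the limit weight and
    -- of the values of `h'` excludes this point.
    refine ENNReal.Tendsto.mul ((hlim x).comp hns.tendsto_atTop) (Or.inr (by finiteness))
      ((ENNReal.continuous_pow 2).tendsto _ |>.comp h1.enorm) (Or.inr h2)
  rw [lintegral_congr_ae hpt]
  refine (lintegral_liminf_le' fun n => ?_).trans ?_
  · exact (hw _).aemeasurable.mul ((Lp.aestronglyMeasurable (h (ns n))).enorm.pow_const 2)
  · rw [← (hMt.comp hns.tendsto_atTop).liminf_eq]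
    exact liminf_le_liminf (Eventually.of_forall fun n => hM (ns n))

end Fatou

/-! ### Hardy's inequality with a regularized weight -/

section Hardy

theorem integral_norm_sq_eq {F : Type*} [NormedAddCommGroup F] [InnerProductSpace ℂ F]
    (h : Lp F 2 (volume : Measure E3)) : ∫ x, ‖h x‖ ^ 2 = ‖h‖ ^ 2 := by
  have h1 := L2.inner_def (𝕜 := ℂ) h h
  rw [inner_self_eq_norm_sq_to_K] at h1
  simp_rw [inner_self_eq_norm_sq_to_K] at h1
  apply Complex.ofReal_injective
  rw [← integral_complex_ofReal]
  simpa using h1.symm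

theorem sum_sq_eq_norm_sq (x : E3) : ∑ j, x j ^ 2 = ‖x‖ ^ 2 := by
  simp [EuclideanSpace.norm_sq_eq]

/-- A regularized Hardy inequality in dimension three. -/
theorem integral_hardy_regularized {f : E3 → C3} (hf : Differentiable ℝ f)
    (h2 : MemLp f 2 volume)
    (h2' : ∀ j, MemLp (fun x => fderiv ℝ f x (basisVec j)) 2 volume) {η : ℝ} (hη : 0 < η) :
    Integrable (fun x => (‖x‖ ^ 2 + η)⁻¹ * ‖f x‖ ^ 2) ∧
    ∫ x, (‖x‖ ^ 2 + η)⁻¹ * ‖f x‖ ^ 2 ≤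
      4 * ∑ j, ∫ x, ‖fderiv ℝ f x (basisVec j)‖ ^ 2 := by
  let D : E3 → ℝ := fun x => (‖x‖ ^ 2 + η)⁻¹
  have hpos : ∀ x : E3, 0 < ‖x‖ ^ 2 + η := fun x => by positivity
  have hD0 : ∀ x, 0 < D x := fun x => inv_pos.2 (hpos x)
  have hDη : ∀ x, D x ≤ η⁻¹ := fun x => inv_anti₀ hη (by nlinarith [sq_nonneg ‖x‖])
  have hDr : ∀ x, D x * ‖x‖ ^ 2 ≤ 1 := fun x => by
    rw [inv_mul_le_iff₀ (hpos x)]; linarith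
  have hDc : Continuous D := by
    refine Continuous.inv₀ (by fun_prop) fun x => (hpos x).ne'
  let a : E3 → ℝ := fun x => ‖f x‖ ^ 2
  have ha : Integrable a := h2.integrable_norm_pow two_ne_zero
  have had : ∀ x, HasFDerivAt a ((2 : ℕ) • (innerSL ℝ (f x)).comp (fderiv ℝ f x)) x := fun x =>
    ((hf x).hasFDerivAt).norm_sq
  have had' : ∀ x j, fderiv ℝ a x (basisVec j) =
      2 * inner ℝ (f x) (fderiv ℝ f x (basisVec j)) := fun x j => by
    rw [(had x).fderiv, two_nsmul, two_mul]; rfl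
  let b : Fin 3 → E3 → ℝ := fun j x => ‖fderiv ℝ f x (basisVec j)‖ ^ 2
  have hb : ∀ j, Integrable (b j) := fun j => (h2' j).integrable_norm_pow two_ne_zero
  have hbd : ∀ x j, |fderiv ℝ a x (basisVec j)| ≤ a x + b j x := fun x j => by
    rw [had', abs_mul, abs_two]
    have := abs_real_inner_le_norm (f x) (fderiv ℝ f x (basisVec j))
    nlinarith [sq_nonneg (‖f x‖ - ‖fderiv ℝ f x (basisVec j)‖)]
  have hda : ∀ j, Integrable fun x => fderiv ℝ a x (basisVec j) := fun j => by
    refine (ha.add (hb j)).mono' ?_ (ae_of_all _ fun x => hbd x j)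
    simp_rw [had']
    exact (h2.1.inner (h2' j).1).const_mul 2
  -- The field `V = x / (|x|² + η)` satisfies `div V = 3D - 2|x|²D² ≥ D` and `|V|² ≤ D`. Thus `∫
  -- D|f|² ≤ ∫ div V |f|² = -∫ V · ∇|f|²`, and half of the left side is absorbed after Young's
  -- inequality. With `η > 0` everything is smooth and bounded.
  let V : Fin 3 → E3 → ℝ := fun j x => x j * D x
  have hVd : ∀ j x, HasFDerivAt (V j)
      (x j • (-((‖x‖ ^ 2 + η) ^ 2)⁻¹ • ((2 : ℝ) • (innerSL ℝ x))) +
        D x • (EuclideanSpace.proj (𝕜 := ℝ) j : E3 →L[ℝ] ℝ)) x := fun j x => by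
    have h3 : HasFDerivAt (fun x : E3 => ‖x‖ ^ 2 + η) ((2 : ℝ) • (innerSL ℝ x)) x := by
      have h4 := ((hasFDerivAt_id (𝕜 := ℝ) x).norm_sq).add_const η
      rwa [← Nat.cast_smul_eq_nsmul ℝ] at h4
    have h4 := (hasDerivAt_inv (hpos x).ne').comp_hasFDerivAt x h3
    exact ((EuclideanSpace.proj (𝕜 := ℝ) j : E3 →L[ℝ] ℝ).hasFDerivAt).mul h4
  have hVd' : ∀ j x, fderiv ℝ (V j) x (basisVec j) = D x - 2 * (x j) ^ 2 * D x ^ 2 := fun j x => by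
    rw [(hVd j x).fderiv]
    have h3 : innerSL ℝ x (basisVec j) = x j := by
      change inner ℝ x (basisVec j) = x j
      simp [basisVec, EuclideanSpace.inner_single_right]
    simp only [add_apply, smul_apply, h3, smul_eq_mul, D]
    simp [basisVec]
    ring
  have hxj : ∀ (x : E3) j, x j ^ 2 ≤ ‖x‖ ^ 2 := fun x j => by
    rw [← sum_sq_eq_norm_sq]
    exact Finset.single_le_sum (f := fun j => x j ^ 2) (fun i _ => sq_nonneg _) (Finset.mem_univ j)
  have hVsq : ∀ j x, V j x ^ 2 ≤ η⁻¹ := fun j x => by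
    have : V j x ^ 2 = x j ^ 2 * D x * D x := by simp only [V]; ring
    rw [this]
    have h3 : x j ^ 2 * D x ≤ 1 := by
      have := mul_le_mul_of_nonneg_left (hxj x j) (hD0 x).le
      linarith [hDr x]
    calc _ ≤ 1 * D x := mul_le_mul_of_nonneg_right h3 (hD0 x).le
      _ ≤ _ := by rw [one_mul]; exact hDη x
  have hVc : ∀ j, Continuous (V j) := fun j =>
    (by fun_prop : Continuous fun x : E3 => x j).mul hDc
  have hVb : ∀ j x, ‖V j x‖ ≤ 1 + η⁻¹ := fun j x => by
    rw [Real.norm_eq_abs]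
    nlinarith [hVsq j x, sq_abs (V j x), sq_nonneg (|V j x| - 1), abs_nonneg (V j x)]
  have hVc' : ∀ j, Continuous fun x => fderiv ℝ (V j) x (basisVec j) := fun j => by
    simp_rw [hVd']
    have : Continuous fun x : E3 => x j := by fun_prop
    exact hDc.sub ((continuous_const.mul (this.pow 2)).mul (hDc.pow 2))
  have hVb' : ∀ j x, ‖fderiv ℝ (V j) x (basisVec j)‖ ≤ 3 * η⁻¹ := fun j x => by
    rw [hVd']
    have h3 := hVsq j x
    have h4 : V j x ^ 2 = x j ^ 2 * D x ^ 2 := by simp only [V]; ring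
    have h5 := sq_nonneg (V j x)
    rw [Real.norm_eq_abs, abs_le]
    constructor <;> nlinarith [hD0 x, hDη x]
  have i1 : ∀ j, Integrable fun x => fderiv ℝ (V j) x (basisVec j) * a x := fun j =>
    ha.bdd_mul (hVc' j).aestronglyMeasurable (ae_of_all _ (hVb' j))
  have i2 : ∀ j, Integrable fun x => V j x * fderiv ℝ a x (basisVec j) := fun j =>
    (hda j).bdd_mul (hVc j).aestronglyMeasurable (ae_of_all _ (hVb j))
  have i3 : ∀ j, Integrable fun x => V j x * a x := fun j =>
    ha.bdd_mul (hVc j).aestronglyMeasurable (ae_of_all _ (hVb j))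
  have ibp : ∀ j, ∫ x, V j x * fderiv ℝ a x (basisVec j) =
      -∫ x, fderiv ℝ (V j) x (basisVec j) * a x := fun j =>
    integral_mul_fderiv_eq_neg_fderiv_mul_of_integrable (i1 j) (i2 j) (i3 j)
      (fun x _ => (hVd j x).differentiableAt) (fun x _ => (had x).differentiableAt)
  have i4 : Integrable fun x => D x * a x :=
    ha.bdd_mul hDc.aestronglyMeasurable (ae_of_all _ fun x => by
      rw [Real.norm_of_nonneg (hD0 x).le]; exact hDη x)
  refine ⟨i4, ?_⟩
  have s1 : ∫ x, D x * a x ≤ ∫ x, ∑ j, fderiv ℝ (V j) x (basisVec j) * a x := by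
    refine integral_mono i4 (integrable_finsetSum _ fun j _ => i1 j) fun x => ?_
    simp only
    rw [← Finset.sum_mul]
    refine mul_le_mul_of_nonneg_right ?_ (sq_nonneg _)
    simp_rw [hVd']
    have : ∑ j : Fin 3, (D x - 2 * x j ^ 2 * D x ^ 2) = 3 * D x - 2 * ‖x‖ ^ 2 * D x ^ 2 := by
      rw [← sum_sq_eq_norm_sq]; simp only [Fin.sum_univ_three]; ring
    rw [this]
    nlinarith [hDr x, hD0 x]
  have s2 : ∫ x, ∑ j, fderiv ℝ (V j) x (basisVec j) * a x =
      ∫ x, ∑ j, -(V j x * fderiv ℝ a x (basisVec j)) := by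
    rw [integral_finsetSum _ fun j _ => i1 j, integral_finsetSum _ fun j _ =>
      (show Integrable fun x => -(V j x * fderiv ℝ a x (basisVec j)) from (i2 j).neg)]
    refine Finset.sum_congr rfl fun j _ => ?_
    rw [integral_neg, ibp, neg_neg]
  have s3 : ∫ x, ∑ j, -(V j x * fderiv ℝ a x (basisVec j)) ≤
      ∫ x, ((1 / 2) * (D x * a x) + ∑ j, 2 * b j x) := by
    refine integral_mono (integrable_finsetSum _ fun j _ => (i2 j).neg)
      ((i4.const_mul _).add (integrable_finsetSum _ fun j _ => (hb j).const_mul 2)) fun x => ?_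
    simp only
    -- Young's inequality `2pq ≤ p²/2 + 2q²` with `p = |Vⱼ| |f|` and `q = |∂ⱼf|`. The weight `1/2`
    -- allows the absorption and produces the Hardy constant `4`.
    have h3 : ∀ j, -(V j x * fderiv ℝ a x (basisVec j)) ≤ (1 / 2) * (V j x ^ 2 * a x) + 2 * b j x := by
      intro j
      rw [had']
      have h4 := abs_real_inner_le_norm (f x) (fderiv ℝ f x (basisVec j))
      have h5 : -(V j x * (2 * inner ℝ (f x) (fderiv ℝ f x (basisVec j)))) ≤
          2 * (|V j x| * (‖f x‖ * ‖fderiv ℝ f x (basisVec j)‖)) := by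
        calc _ ≤ |V j x * (2 * inner ℝ (f x) (fderiv ℝ f x (basisVec j)))| := neg_le_abs _
          _ = 2 * (|V j x| * |inner ℝ (f x) (fderiv ℝ f x (basisVec j))|) := by
            rw [abs_mul (V j x), abs_mul 2, abs_two]; ring
          _ ≤ _ := by gcongr
      refine h5.trans ?_
      have h6 := sq_nonneg (|V j x| * ‖f x‖ - 2 * ‖fderiv ℝ f x (basisVec j)‖)
      have h7 : V j x ^ 2 * a x = (|V j x| * ‖f x‖) ^ 2 :=
        ((mul_pow |V j x| ‖f x‖ 2).trans (by rw [sq_abs])).symm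
      rw [h7]
      simp only [b]
      nlinarith
    refine (Finset.sum_le_sum fun j _ => h3 j).trans ?_
    rw [Finset.sum_add_distrib]
    refine add_le_add ?_ le_rfl
    rw [← Finset.mul_sum, ← Finset.sum_mul]
    refine mul_le_mul_of_nonneg_left (mul_le_mul_of_nonneg_right ?_ (sq_nonneg _)) (by norm_num)
    have : ∑ j, V j x ^ 2 = D x * ‖x‖ ^ 2 * D x := by
      rw [← sum_sq_eq_norm_sq]; simp only [V, Fin.sum_univ_three]; ring
    rw [this]
    exact mul_le_of_le_one_left (hD0 x).le (hDr x)
  have s4 : ∫ x, ((1 / 2) * (D x * a x) + ∑ j, 2 * b j x) =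
      (1 / 2) * (∫ x, D x * a x) + 2 * ∑ j, ∫ x, b j x := by
    rw [integral_add (i4.const_mul _) (integrable_finsetSum _ fun j _ => (hb j).const_mul 2),
      integral_const_mul, integral_finsetSum _ fun j _ => (hb j).const_mul 2, Finset.mul_sum]
    simp_rw [integral_const_mul]
  have s5 := s1.trans (s2.trans_le (s3.trans_eq s4))
  change ∫ x, D x * a x ≤ 4 * ∑ j, ∫ x, b j x
  linarith

end Hardy

/-! ### Hardy's inequality on the frequency side -/

section HardyFourier

/-- Bounded support makes `k` and `|x| k` integrable, so `f = k̂` is classically differentiable with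
`∂ⱼf` the transform of `-2πi xⱼ k`. The regularized inequality for `f` and Plancherel give the
constant `4 · 4π²`. -/
theorem lintegral_hardy_fourier_of_bounded_support (k : Lp C3 2 (volume : Measure E3)) {R : ℝ}
    (hk : ∀ᵐ x, x ∉ Metric.closedBall (0 : E3) R → k x = 0) {η : ℝ} (hη : 0 < η) :
    ∫⁻ ξ, (‖ξ‖ₑ ^ 2 + ENNReal.ofReal η)⁻¹ * ‖(𝓕 k : Lp C3 2 (volume : Measure E3)) ξ‖ₑ ^ 2 ≤
      ENNReal.ofReal (16 * Real.pi ^ 2) * ∫⁻ x, ‖x‖ₑ ^ 2 * ‖k x‖ₑ ^ 2 := by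
  have hR : ∀ᵐ x, ‖x‖ * ‖k x‖ ≤ |R| * ‖k x‖ := by
    filter_upwards [hk] with x hx
    by_cases h : x ∈ Metric.closedBall (0 : E3) R
    · rw [mem_closedBall_zero_iff] at h
      exact mul_le_mul_of_nonneg_right (h.trans (le_abs_self R)) (norm_nonneg _)
    · rw [hx h]; simp
  have hint : Integrable k := by
    have h1 : IntegrableOn k (Metric.closedBall 0 R) := by
      have : IsFiniteMeasure (volume.restrict (Metric.closedBall (0 : E3) R)) :=
        ⟨by rw [Measure.restrict_apply_univ]; exact measure_closedBall_lt_top⟩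
      exact memLp_one_iff_integrable.1 (((Lp.memLp k).restrict _).mono_exponent one_le_two)
    exact h1.integrable_of_ae_notMem_eq_zero hk
  have hint' : Integrable fun x => ‖x‖ * ‖k x‖ := by
    refine (hint.norm.const_mul |R|).mono'
      (continuous_norm.aestronglyMeasurable.mul (Lp.aestronglyMeasurable k).norm) ?_
    filter_upwards [hR] with x hx
    rwa [Real.norm_of_nonneg (by positivity)]
  have hcoord : ∀ (x : E3) j, ‖-(2 * Real.pi * Complex.I) * (x j : ℂ)‖ ≤ 2 * Real.pi * ‖x‖ := by
    intro x j
    simp only [norm_mul, norm_neg, Complex.norm_I, mul_one, Complex.norm_real,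
      Complex.norm_ofNat, Real.norm_of_nonneg Real.pi_pos.le]
    gcongr
    exact PiLp.norm_apply_le x j
  have hmem : ∀ j : Fin 3, MemLp (fun x => (-(2 * Real.pi * Complex.I) * (x j : ℂ)) • k x) 2
      volume := fun j => by
    refine (Lp.memLp k).of_le_mul (c := 2 * Real.pi * |R|) ?_ ?_
    · have : Continuous fun x : E3 => (-(2 * Real.pi * Complex.I) * (x j : ℂ)) := by fun_prop
      exact this.aestronglyMeasurable.smul (Lp.aestronglyMeasurable k)
    · filter_upwards [hR] with x hx
      rw [norm_smul]
      calc _ ≤ 2 * Real.pi * ‖x‖ * ‖k x‖ :=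
            mul_le_mul_of_nonneg_right (hcoord x j) (norm_nonneg _)
        _ = 2 * Real.pi * (‖x‖ * ‖k x‖) := by ring
        _ ≤ 2 * Real.pi * (|R| * ‖k x‖) := by gcongr
        _ = _ := by ring
  have hmemi : ∀ j : Fin 3, Integrable fun x => (-(2 * Real.pi * Complex.I) * (x j : ℂ)) • k x :=
    fun j => by
      refine (hint'.const_mul (2 * Real.pi)).mono' (hmem j).1 (ae_of_all _ fun x => ?_)
      rw [norm_smul, ← mul_assoc]
      exact mul_le_mul_of_nonneg_right (hcoord x j) (norm_nonneg _)
  set f : E3 → C3 := 𝓕 (k : E3 → C3) with hf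
  have hdiff : Differentiable ℝ f := Real.differentiable_fourier hint hint'
  have hkf : (𝓕 k : Lp C3 2 (volume : Measure E3)) =ᵐ[volume] f :=
    fourier_ae_eq_fourierIntegral k hint
  have hf2 : MemLp f 2 volume := (memLp_congr_ae hkf).1 (Lp.memLp _)
  let K : Fin 3 → Lp C3 2 (volume : Measure E3) := fun j => (hmem j).toLp
  have hK : ∀ j, (K j : E3 → C3) =ᵐ[volume]
      fun x => (-(2 * Real.pi * Complex.I) * (x j : ℂ)) • k x := fun j => (hmem j).coeFn_toLp
  have hfd : ∀ j, (𝓕 (K j) : Lp C3 2 (volume : Measure E3)) =ᵐ[volume]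
      fun ξ => fderiv ℝ f ξ (basisVec j) := fun j => by
    have h1 := fourier_ae_eq_fourierIntegral (K j) ((hmemi j).congr (hK j).symm)
    refine h1.trans (ae_of_all _ fun ξ => ?_)
    rw [Real.fourier_congr_ae (hK j), hf, Real.fderiv_fourier hint hint']
    dsimp only
    rw [Real.fourier_continuousLinearMap_apply]
    · refine congrArg (fun h : E3 → C3 => (𝓕 h) ξ) (funext fun x => ?_)
      rw [VectorFourier.fourierSMulRight_apply]
      have h3 : innerSL ℝ x (basisVec j) = x j := by
        change inner ℝ x (basisVec j) = x j
        simp [basisVec, EuclideanSpace.inner_single_right]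
      rw [h3, mul_smul, Complex.coe_smul]
    · refine (hint'.const_mul (2 * Real.pi * ‖innerSL ℝ (E := E3)‖)).mono'
        hint.1.fourierSMulRight (ae_of_all _ fun x => ?_)
      exact (VectorFourier.norm_fourierSMulRight_le _ _ _).trans_eq (by ring)
  have hfd2 : ∀ j, MemLp (fun ξ => fderiv ℝ f ξ (basisVec j)) 2 volume := fun j =>
    (memLp_congr_ae (hfd j)).1 (Lp.memLp _)
  obtain ⟨hi, hle⟩ := integral_hardy_regularized hdiff hf2 hfd2 hη
  have hKn : ∀ j, ∫ ξ, ‖fderiv ℝ f ξ (basisVec j)‖ ^ 2 =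
      ∫ x, 4 * Real.pi ^ 2 * (x j ^ 2 * ‖k x‖ ^ 2) := fun j => by
    have h1 := integral_norm_sq_eq (𝓕 (K j) : Lp C3 2 (volume : Measure E3))
    rw [Lp.norm_fourier_eq, ← integral_norm_sq_eq] at h1
    have h2 : ∫ ξ, ‖fderiv ℝ f ξ (basisVec j)‖ ^ 2 =
        ∫ ξ, ‖(𝓕 (K j) : Lp C3 2 (volume : Measure E3)) ξ‖ ^ 2 :=
      integral_congr_ae (by filter_upwards [hfd j] with ξ hξ; rw [hξ])
    rw [h2, h1]
    refine integral_congr_ae ?_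
    filter_upwards [hK j] with x hx
    rw [hx, norm_smul]
    simp only [norm_mul, norm_neg, Complex.norm_I, mul_one, Complex.norm_real,
      Complex.norm_ofNat, Real.norm_eq_abs, mul_pow, sq_abs]
    ring
  have hxk : Integrable fun x => ‖x‖ ^ 2 * ‖k x‖ ^ 2 := by
    refine ((Lp.memLp k).integrable_norm_pow two_ne_zero |>.const_mul (|R| ^ 2)).mono'
      ((continuous_norm.pow 2).aestronglyMeasurable.mul ((Lp.aestronglyMeasurable k).norm.pow 2)) ?_
    filter_upwards [hR] with x hx
    rw [Real.norm_of_nonneg (by positivity), ← mul_pow, ← mul_pow]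
    exact pow_le_pow_left₀ (by positivity) hx 2
  have hxkj : ∀ j, Integrable fun x => 4 * Real.pi ^ 2 * (x j ^ 2 * ‖k x‖ ^ 2) := fun j => by
    refine (hxk.const_mul (4 * Real.pi ^ 2)).mono' ?_ (ae_of_all _ fun x => ?_)
    · have : Continuous fun x : E3 => x j := by fun_prop
      exact ((this.pow 2).aestronglyMeasurable.mul
        ((Lp.aestronglyMeasurable k).norm.pow 2)).const_mul _
    · rw [Real.norm_of_nonneg (by positivity), ← sum_sq_eq_norm_sq]
      gcongr
      exact Finset.single_le_sum (f := fun j => x j ^ 2) (fun i _ => sq_nonneg _)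
        (Finset.mem_univ j)
  have hsum : 4 * ∑ j, ∫ ξ, ‖fderiv ℝ f ξ (basisVec j)‖ ^ 2 =
      16 * Real.pi ^ 2 * ∫ x, ‖x‖ ^ 2 * ‖k x‖ ^ 2 := by
    simp_rw [hKn]
    rw [← integral_finsetSum _ fun j _ => hxkj j, ← integral_const_mul, ← integral_const_mul]
    refine integral_congr_ae (ae_of_all _ fun x => ?_)
    simp only
    rw [← Finset.mul_sum, ← Finset.sum_mul, sum_sq_eq_norm_sq]
    ring
  rw [hsum] at hle
  have hl : ∫⁻ ξ, (‖ξ‖ₑ ^ 2 + ENNReal.ofReal η)⁻¹ *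
      ‖(𝓕 k : Lp C3 2 (volume : Measure E3)) ξ‖ₑ ^ 2 =
      ENNReal.ofReal (∫ ξ, (‖ξ‖ ^ 2 + η)⁻¹ * ‖f ξ‖ ^ 2) := by
    rw [ofReal_integral_eq_lintegral_ofReal hi (ae_of_all _ fun ξ => by positivity)]
    refine lintegral_congr_ae ?_
    filter_upwards [hkf] with ξ hξ
    rw [hξ, ENNReal.ofReal_mul (by positivity), ENNReal.ofReal_inv_of_pos (by positivity),
      ENNReal.ofReal_add (by positivity) hη.le, ENNReal.ofReal_pow (norm_nonneg _),
      ENNReal.ofReal_pow (norm_nonneg _), ofReal_norm, ofReal_norm]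
  have hr : ∫⁻ x, ‖x‖ₑ ^ 2 * ‖k x‖ₑ ^ 2 = ENNReal.ofReal (∫ x, ‖x‖ ^ 2 * ‖k x‖ ^ 2) := by
    rw [ofReal_integral_eq_lintegral_ofReal hxk (ae_of_all _ fun ξ => by positivity)]
    refine lintegral_congr fun x => ?_
    rw [ENNReal.ofReal_mul (by positivity), ENNReal.ofReal_pow (norm_nonneg _),
      ENNReal.ofReal_pow (norm_nonneg _), ofReal_norm, ofReal_norm]
  rw [hl, hr, ← ENNReal.ofReal_mul (by positivity)]
  exact ENNReal.ofReal_le_ofReal hle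

/-- Hardy's inequality on the frequency side: `∫ |ξ|⁻²|ĝ|² ≤ 16π² ∫ |x|²|g|²`. -/
theorem lintegral_hardy_fourier (g : Lp C3 2 (volume : Measure E3)) :
    ∫⁻ ξ, (‖ξ‖ₑ ^ 2)⁻¹ * ‖(𝓕 g : Lp C3 2 (volume : Measure E3)) ξ‖ₑ ^ 2 ≤
      ENNReal.ofReal (16 * Real.pi ^ 2) * ∫⁻ x, ‖x‖ₑ ^ 2 * ‖g x‖ₑ ^ 2 := by
  let s : ℕ → Set E3 := fun n => Metric.closedBall 0 n
  have hs : ∀ n, MeasurableSet (s n) := fun n => measurableSet_closedBall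
  let k : ℕ → Lp C3 2 (volume : Measure E3) := fun n => ((Lp.memLp g).indicator (hs n)).toLp
  have hk : ∀ n, (k n : E3 → C3) =ᵐ[volume] (s n).indicator g := fun n => MemLp.coeFn_toLp _
  have hkt : Tendsto k atTop (𝓝 g) := by
    rw [tendsto_iff_norm_sub_tendsto_zero]
    have h1 : Tendsto (fun n => ‖k n - g‖ ^ 2) atTop (𝓝 0) := by
      simp_rw [← integral_norm_sq_eq]
      have h2 : ∀ n, ∫ x, ‖(k n - g : Lp C3 2 (volume : Measure E3)) x‖ ^ 2 =
          ∫ x, (s n)ᶜ.indicator (fun x => ‖g x‖ ^ 2) x := fun n => by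
        refine integral_congr_ae ?_
        filter_upwards [Lp.coeFn_sub (k n) g, hk n] with x a1 a2
        rw [a1, Pi.sub_apply, a2]
        by_cases hx : x ∈ s n
        · simp [hx]
        · simp [hx]
      simp_rw [h2]
      have h3 : Integrable fun x => ‖g x‖ ^ 2 := (Lp.memLp g).integrable_norm_pow two_ne_zero
      rw [← integral_zero E3 ℝ (μ := volume)]
      refine tendsto_integral_of_dominated_convergence (fun x => ‖g x‖ ^ 2)
        (fun n => h3.1.indicator (hs n).compl) h3 (fun n => ae_of_all _ fun x => ?_)
        (ae_of_all _ fun x => ?_)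
      · refine (norm_indicator_le_norm_self _ _).trans_eq ?_
        rw [Real.norm_of_nonneg (by positivity)]
      · refine tendsto_const_nhds.congr' ?_
        obtain ⟨N, hN⟩ := exists_nat_ge ‖x‖
        filter_upwards [eventually_ge_atTop N] with n hn
        have : x ∈ s n := by
          rw [mem_closedBall_zero_iff]
          exact hN.trans (by exact_mod_cast hn)
        simp [this]
    have h4 := h1.sqrt
    simpa using h4
  have hkt' : Tendsto (fun n => (𝓕 (k n) : Lp C3 2 (volume : Measure E3))) atTop (𝓝 (𝓕 g)) :=
    ((Lp.fourierTransformₗᵢ E3 C3).continuous.tendsto g).comp hkt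
  -- Truncation to the ball of radius `n` and regularization with `η = 1 / (n + 1)` are removed in a
  -- single passage to the limit. The limit weight is infinite only at the origin.
  refine lintegral_weight_le_of_tendsto
    (w := fun n ξ => (‖ξ‖ₑ ^ 2 + ENNReal.ofReal (((n : ℝ) + 1)⁻¹))⁻¹) (fun n => ?_) (fun ξ => ?_) ?_
    hkt' (M := fun _ => _) tendsto_const_nhds fun n => ?_
  · exact ((measurable_enorm.pow_const 2).add_const _).inv
  · have h1 : Tendsto (fun n : ℕ => ENNReal.ofReal (((n : ℝ) + 1)⁻¹)) atTop (𝓝 0) := by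
      rw [← ENNReal.ofReal_zero]
      refine (ENNReal.continuous_ofReal.tendsto 0).comp ?_
      exact tendsto_inv_atTop_zero.comp
        (tendsto_atTop_add_const_right _ _ tendsto_natCast_atTop_atTop)
    have h2 := (tendsto_const_nhds (x := ‖ξ‖ₑ ^ 2)).add h1
    rw [add_zero] at h2
    exact h2.inv
  · have h0 : ∀ᵐ ξ : E3, ξ ≠ 0 := by simp [ae_iff]
    filter_upwards [h0] with ξ hξ
    simpa using hξ
  · refine (lintegral_hardy_fourier_of_bounded_support (k n) (R := n) ?_ (by positivity)).trans ?_
    · filter_upwards [hk n] with x hx hxn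
      rw [hx]
      exact Set.indicator_of_notMem hxn _
    · refine mul_le_mul_right (lintegral_mono_ae ?_) _
      filter_upwards [hk n] with x hx
      rw [hx]
      gcongr
      exact enorm_indicator_le_enorm_self _ _

end HardyFourier

/-! ### Linearity of the operator graphs -/

section Linearity

theorem memLp_two_of_test {φ : E3 → ℝ} (hφ : ContDiff ℝ ∞ φ) (hc : HasCompactSupport φ) :
    MemLp φ 2 volume :=
  hφ.continuous.memLp_of_hasCompactSupport hc

theorem memLp_two_fderiv_of_test {φ : E3 → ℝ} (hφ : ContDiff ℝ ∞ φ) (hc : HasCompactSupport φ)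
    (v : E3) : MemLp (fun x => fderiv ℝ φ x v) 2 volume :=
  ((hφ.continuous_fderiv (by simp)).clm_apply continuous_const).memLp_of_hasCompactSupport
    (hc.fderiv_apply ℝ v)

theorem integral_smul_add {φ : E3 → ℝ} (hφ : MemLp φ 2 volume) (f f' : L2) :
    ∫ x, φ x • ((f + f' : L2) : E3 → E3) x =
      (∫ x, φ x • (f : E3 → E3) x) + ∫ x, φ x • (f' : E3 → E3) x := by
  rw [← integral_add (integrable_smul_of_memLp_two hφ (Lp.memLp f))
    (integrable_smul_of_memLp_two hφ (Lp.memLp f'))]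
  refine integral_congr_ae ?_
  filter_upwards [Lp.coeFn_add f f'] with x hx
  rw [hx, Pi.add_apply, smul_add]

theorem integral_smul_smul (φ : E3 → ℝ) (a : ℝ) (f : L2) :
    ∫ x, φ x • ((a • f : L2) : E3 → E3) x = a • ∫ x, φ x • (f : E3 → E3) x := by
  rw [← integral_smul]
  refine integral_congr_ae ?_
  filter_upwards [Lp.coeFn_smul a f] with x hx
  rw [hx, Pi.smul_apply, smul_comm]

theorem IsWeakPartial.add {j : Fin 3} {f g f' g' : L2} (h : IsWeakPartial j f g)
    (h' : IsWeakPartial j f' g') : IsWeakPartial j (f + f') (g + g') := fun φ hφ hc => by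
  rw [integral_smul_add (memLp_two_fderiv_of_test hφ hc _)]
  erw [h φ hφ hc, h' φ hφ hc]
  rw [integral_smul_add (memLp_two_of_test hφ hc)]
  abel

theorem IsWeakPartial.smul {j : Fin 3} {f g : L2} (h : IsWeakPartial j f g) (a : ℝ) :
    IsWeakPartial j (a • f) (a • g) := fun φ hφ hc => by
  rw [integral_smul_smul, h φ hφ hc, integral_smul_smul, smul_neg]

theorem IsWeakLaplacian.add {u L u' L' : L2} (h : IsWeakLaplacian u L)
    (h' : IsWeakLaplacian u' L') : IsWeakLaplacian (u + u') (L + L') := by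
  obtain ⟨G, K, hG, hK, rfl⟩ := h
  obtain ⟨G', K', hG', hK', rfl⟩ := h'
  exact ⟨G + G', K + K', fun i => (hG i).add (hG' i), fun i j => (hK i j).add (hK' i j),
    Finset.sum_add_distrib.symm⟩

theorem IsWeakLaplacian.smul {u L : L2} (h : IsWeakLaplacian u L) (a : ℝ) :
    IsWeakLaplacian (a • u) (a • L) := by
  obtain ⟨G, K, hG, hK, rfl⟩ := h
  exact ⟨a • G, a • K, fun i => (hG i).smul a, fun i j => (hK i j).smul a, Finset.smul_sum⟩

theorem IsHermiteStokes.add {u g u' g' : H} (h : IsHermiteStokes u g)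
    (h' : IsHermiteStokes u' g') : IsHermiteStokes (u + u') (g + g') := by
  obtain ⟨L, X, hL, hX, rfl⟩ := h
  obtain ⟨L', X', hL', hX', rfl⟩ := h'
  refine ⟨L + L', X + X', hL.add hL', ?_, ?_⟩
  · filter_upwards [Lp.coeFn_add X X', hX, hX', Lp.coeFn_add (u : L2) (u' : L2)] with x a b c d
    rw [Submodule.coe_add, a, d, Pi.add_apply, Pi.add_apply, b, c, smul_add]
  · rw [← smul_add, ← map_add]
    congr 2
    abel

theorem IsHermiteStokes.smul {u g : H} (h : IsHermiteStokes u g) (a : ℝ) :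
    IsHermiteStokes (a • u) (a • g) := by
  obtain ⟨L, X, hL, hX, rfl⟩ := h
  refine ⟨a • L, a • X, hL.smul a, ?_, ?_⟩
  · filter_upwards [Lp.coeFn_smul a X, hX, Lp.coeFn_smul a (u : L2)] with x a b d
    rw [Submodule.coe_smul, a, d, Pi.smul_apply, Pi.smul_apply, b, smul_comm]
  · rw [smul_comm a, ← map_smul, smul_add, smul_neg]

theorem isHermiteStokes_zero : IsHermiteStokes 0 0 := by
  have hp : ∀ j, IsWeakPartial j 0 0 := fun j φ _ _ => by
    have h : ∀ ψ : E3 → ℝ, ∫ x, ψ x • ((0 : L2) : E3 → E3) x = 0 := fun ψ => by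
      rw [← integral_zero E3 E3 (μ := volume)]
      refine integral_congr_ae ?_
      filter_upwards [Lp.coeFn_zero E3 2 (volume : Measure E3)] with x hx
      rw [hx, Pi.zero_apply, smul_zero]
    rw [h, h, neg_zero]
  refine ⟨0, 0, ⟨0, 0, fun i => hp i, fun i j => hp j, by simp⟩, ?_, by simp⟩
  filter_upwards [Lp.coeFn_zero E3 2 (volume : Measure E3)] with x hx
  change ((0 : L2) : E3 → E3) x = ‖x‖ ^ 2 • ((0 : L2) : E3 → E3) x
  rw [hx, Pi.zero_apply, smul_zero]

theorem isHermiteStokes_sum {ι : Type*} (S : Finset ι) {u g : ι → H}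
    (h : ∀ i ∈ S, IsHermiteStokes (u i) (g i)) :
    IsHermiteStokes (∑ i ∈ S, u i) (∑ i ∈ S, g i) := by
  classical
  induction S using Finset.induction_on with
  | empty => simpa using isHermiteStokes_zero
  | insert i S hi ih =>
    rw [Finset.sum_insert hi, Finset.sum_insert hi]
    exact (h i (Finset.mem_insert_self i S)).add
      (ih fun j hj => h j (Finset.mem_insert_of_mem hj))

end Linearity

/-! ### Symmetry and quadratic form of `B`; the uncertainty principle -/

section Form

theorem inner_smul_left_H (a : ℝ) (x y : H) : inner ℝ (a • x) y = a * inner ℝ x y :=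
  real_inner_smul_left (x : L2) (y : L2) a

theorem inner_smul_right_H (a : ℝ) (x y : H) : inner ℝ x (a • y) = a * inner ℝ x y :=
  real_inner_smul_right (x : L2) (y : L2) a

/-- The second moment of a square integrable field. -/
def moment {F : Type*} [NormedAddCommGroup F] (f : Lp F 2 (volume : Measure E3)) : ℝ≥0∞ :=
  ∫⁻ x, ‖x‖ₑ ^ 2 * ‖f x‖ₑ ^ 2

theorem moment_toC3 (f : L2) : moment (toC3.compLp f) = moment f := by
  refine lintegral_congr_ae ?_
  filter_upwards [toC3.coeFn_compLp f] with x hx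
  rw [hx, ← ofReal_norm (toC3 _), norm_toC3, ofReal_norm]

theorem ofReal_sq_mul_sq {F G : Type*} [NormedAddCommGroup F] [NormedAddCommGroup G] (x : F)
    (y : G) : ENNReal.ofReal (‖x‖ ^ 2 * ‖y‖ ^ 2) = ‖x‖ₑ ^ 2 * ‖y‖ₑ ^ 2 := by
  rw [ENNReal.ofReal_mul (by positivity), ENNReal.ofReal_pow (norm_nonneg _),
    ENNReal.ofReal_pow (norm_nonneg _), ofReal_norm, ofReal_norm]

theorem IsWeakLaplacian.inner_comm {u L u' L' : L2} (h : IsWeakLaplacian u L)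
    (h' : IsWeakLaplacian u' L') : inner ℝ L u' = inner ℝ u L' := by
  apply Complex.ofReal_injective
  rw [← integral_inner_fourierL2, ← integral_inner_fourierL2]
  refine integral_congr_ae ?_
  filter_upwards [h.fourierL2_ae_eq, h'.fourierL2_ae_eq] with ξ a b
  rw [a, b, ← Complex.coe_smul, ← Complex.coe_smul, inner_smul_left, inner_smul_right,
    Complex.conj_ofReal]

theorem IsWeakLaplacian.inner_eq {u L : L2} (h : IsWeakLaplacian u L) :
    0 ≤ -inner ℝ L u ∧
    ENNReal.ofReal (4 * Real.pi ^ 2) * moment (fourierL2 u) = ENNReal.ofReal (-inner ℝ L u) := by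
  have hae : ∀ᵐ ξ, 4 * Real.pi ^ 2 * (‖ξ‖ ^ 2 * ‖fourierL2 u ξ‖ ^ 2) =
      -(inner ℂ (fourierL2 L ξ) (fourierL2 u ξ) : ℂ).re := by
    filter_upwards [h.fourierL2_ae_eq] with ξ a
    rw [a, ← Complex.coe_smul, inner_smul_left, Complex.conj_ofReal, inner_self_eq_norm_sq_to_K]
    simp [← Complex.ofReal_pow]
    ring
  have hint : Integrable fun ξ => 4 * Real.pi ^ 2 * (‖ξ‖ ^ 2 * ‖fourierL2 u ξ‖ ^ 2) :=
    (integrable_inner_fourierL2 L u).re.neg.congr (hae.mono fun ξ h => h.symm)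
  have e : -inner ℝ L u = ∫ ξ, 4 * Real.pi ^ 2 * (‖ξ‖ ^ 2 * ‖fourierL2 u ξ‖ ^ 2) := by
    rw [integral_congr_ae hae, integral_neg]
    have h1 := congrArg Complex.re (integral_inner_fourierL2 L u)
    rw [Complex.ofReal_re] at h1
    rw [← h1]
    congr 1
    exact (integral_re (integrable_inner_fourierL2 L u)).symm
  rw [e]
  refine ⟨integral_nonneg fun ξ => by positivity, ?_⟩
  rw [ofReal_integral_eq_lintegral_ofReal hint (ae_of_all _ fun ξ => by positivity), moment,
    ← lintegral_const_mul' _ _ ENNReal.ofReal_ne_top]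
  refine lintegral_congr fun ξ => ?_
  rw [ENNReal.ofReal_mul (p := 4 * Real.pi ^ 2) (by positivity), ofReal_sq_mul_sq]

theorem inner_normSq_mul_comm {u X u' X' : L2}
    (hX : (X : E3 → E3) =ᵐ[volume] fun x => ‖x‖ ^ 2 • (u : E3 → E3) x)
    (hX' : (X' : E3 → E3) =ᵐ[volume] fun x => ‖x‖ ^ 2 • (u' : E3 → E3) x) :
    inner ℝ X u' = inner ℝ u X' := by
  rw [L2.inner_def, L2.inner_def]
  refine integral_congr_ae ?_
  filter_upwards [hX, hX'] with x a b
  rw [a, b, real_inner_smul_left, real_inner_smul_right]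

theorem inner_normSq_mul_eq {u X : L2}
    (hX : (X : E3 → E3) =ᵐ[volume] fun x => ‖x‖ ^ 2 • (u : E3 → E3) x) :
    0 ≤ inner ℝ X u ∧ moment u = ENNReal.ofReal (inner ℝ X u) := by
  have hae : ∀ᵐ x, inner ℝ ((X : E3 → E3) x) ((u : E3 → E3) x) =
      ‖x‖ ^ 2 * ‖(u : E3 → E3) x‖ ^ 2 := by
    filter_upwards [hX] with x a
    rw [a, real_inner_smul_left, real_inner_self_eq_norm_sq]
  rw [L2.inner_def, integral_congr_ae hae]
  refine ⟨integral_nonneg fun ξ => by positivity, ?_⟩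
  rw [ofReal_integral_eq_lintegral_ofReal ((L2.integrable_inner X u).congr hae)
    (ae_of_all _ fun ξ => by positivity), moment]
  exact lintegral_congr fun ξ => (ofReal_sq_mul_sq _ _).symm

theorem inner_leray (f : L2) (u : H) : inner ℝ (leray f) u = inner ℝ f (u : L2) := by
  rw [Submodule.coe_inner]
  exact Submodule.inner_starProjection_left_eq_right H f u |>.trans
    (by rw [Submodule.starProjection_eq_self_iff.2 u.2])

/-- The Hermite-Stokes operator is symmetric. -/
theorem IsHermiteStokes.inner_comm {u g u' g' : H} (h : IsHermiteStokes u g)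
    (h' : IsHermiteStokes u' g') : inner ℝ g u' = inner ℝ u g' := by
  obtain ⟨L, X, hL, hX, rfl⟩ := h
  obtain ⟨L', X', hL', hX', rfl⟩ := h'
  rw [inner_smul_left_H, inner_smul_right_H, inner_leray, real_inner_comm, real_inner_comm _ u,
    inner_leray, real_inner_comm, real_inner_comm (u : L2)]
  rw [inner_add_left, inner_add_right, inner_neg_left, inner_neg_right, hL.inner_comm hL',
    inner_normSq_mul_comm hX hX']

/-- The quadratic form of the Hermite-Stokes operator. -/
theorem IsHermiteStokes.form_eq {u g : H} (h : IsHermiteStokes u g) :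
    moment (u : L2) + ENNReal.ofReal (4 * Real.pi ^ 2) * moment (fourierL2 (u : L2)) =
      ENNReal.ofReal (2 * inner ℝ g u) := by
  obtain ⟨L, X, hL, hX, rfl⟩ := h
  obtain ⟨h1, h2⟩ := hL.inner_eq
  obtain ⟨h3, h4⟩ := inner_normSq_mul_eq hX
  rw [h2, h4, ← ENNReal.ofReal_add h3 h1, inner_smul_left_H, inner_leray, inner_add_left,
    inner_neg_left]
  congr 1
  ring

/-- The uncertainty principle. -/
theorem ofReal_norm_sq_le (u : L2) : ENNReal.ofReal (‖u‖ ^ 2) ≤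
    moment u + ENNReal.ofReal (4 * Real.pi ^ 2) * moment (fourierL2 u) := by
  have hardy := lintegral_hardy_fourier (toC3.compLp u)
  change ∫⁻ ξ, (‖ξ‖ₑ ^ 2)⁻¹ * ‖fourierL2 u ξ‖ₑ ^ 2 ≤ _ * moment (toC3.compLp u) at hardy
  rw [moment_toC3] at hardy
  have e1 : ENNReal.ofReal (‖u‖ ^ 2) = ∫⁻ ξ, ‖fourierL2 u ξ‖ₑ ^ 2 := by
    rw [← fourierL2.norm_map u, ← integral_norm_sq_eq, ofReal_integral_eq_lintegral_ofReal
      ((Lp.memLp _).integrable_norm_pow two_ne_zero) (ae_of_all _ fun ξ => by positivity)]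
    refine lintegral_congr fun ξ => ?_
    rw [ENNReal.ofReal_pow (norm_nonneg _), ofReal_norm]
  have hpi : 0 < Real.pi ^ 2 := by positivity
  -- Pointwise `1 ≤ 1/(4t) + t` with `t = 4π²|ξ|²`. The coefficient of `|ξ|⁻²` is the inverse of the
  -- Hardy constant, so that term integrates to at most the second moment of `u`.
  have e2 : ∀ᵐ ξ : E3, ‖fourierL2 u ξ‖ₑ ^ 2 ≤
      ENNReal.ofReal (16 * Real.pi ^ 2)⁻¹ * ((‖ξ‖ₑ ^ 2)⁻¹ * ‖fourierL2 u ξ‖ₑ ^ 2) +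
      ENNReal.ofReal (4 * Real.pi ^ 2) * (‖ξ‖ₑ ^ 2 * ‖fourierL2 u ξ‖ₑ ^ 2) := by
    have h0 : ∀ᵐ ξ : E3, ξ ≠ 0 := by simp [ae_iff]
    filter_upwards [h0] with ξ hξ
    have hξ' : 0 < ‖ξ‖ := norm_pos_iff.2 hξ
    rw [← mul_assoc, ← mul_assoc, ← add_mul]
    refine le_mul_of_one_le_left' ?_
    have : ‖ξ‖ₑ ^ 2 = ENNReal.ofReal (‖ξ‖ ^ 2) := by
      rw [ENNReal.ofReal_pow (norm_nonneg _), ofReal_norm]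
    rw [this, ← ENNReal.ofReal_inv_of_pos (by positivity), ← ENNReal.ofReal_mul (by positivity),
      ← ENNReal.ofReal_mul (by positivity), ← ENNReal.ofReal_add (by positivity) (by positivity),
      ENNReal.one_le_ofReal, ← mul_inv]
    set t := 4 * Real.pi ^ 2 * ‖ξ‖ ^ 2 with ht
    have ht0 : 0 < t := by positivity
    have : 16 * Real.pi ^ 2 * ‖ξ‖ ^ 2 = 4 * t := by rw [ht]; ring
    rw [this]
    have h4 : (4 * t)⁻¹ + t - 1 = (2 * t - 1) ^ 2 * (4 * t)⁻¹ := by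
      field_simp
      ring
    have : 0 ≤ (2 * t - 1) ^ 2 * (4 * t)⁻¹ := by positivity
    linarith
  rw [e1]
  refine (lintegral_mono_ae e2).trans ?_
  rw [lintegral_add_left', lintegral_const_mul' _ _ ENNReal.ofReal_ne_top,
    lintegral_const_mul' _ _ ENNReal.ofReal_ne_top]
  · refine add_le_add ((mul_le_mul_right hardy _).trans_eq ?_) le_rfl
    rw [← mul_assoc, ← ENNReal.ofReal_mul (by positivity), inv_mul_cancel₀ (by positivity),
      ENNReal.ofReal_one, one_mul]
  · exact ((measurable_enorm.pow_const 2).inv.aemeasurable.mul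
      ((Lp.aestronglyMeasurable (fourierL2 u)).enorm.pow_const 2)).const_mul _

/-- For an eigenvector the uncertainty principle reads `‖u‖² ≤ 2⟨Bu, u⟩ = 2μ‖u‖²`. Any positive
lower bound would serve: it keeps the coefficients `μ^{-β}` bounded and `λ₁` away from `0`. -/
theorem half_le_of_mem_eigenvaluesB {μ : ℝ} (hμ : μ ∈ eigenvaluesB) : 1 / 2 ≤ μ := by
  obtain ⟨u, hu, h⟩ := hμ
  have h1 := (ofReal_norm_sq_le (u : L2)).trans_eq h.form_eq
  have hn : 0 < ‖u‖ := norm_pos_iff.2 hu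
  rw [inner_smul_left_H, real_inner_self_eq_norm_sq] at h1
  have h2 : ‖u‖ ^ 2 ≤ 2 * (μ * ‖u‖ ^ 2) := by
    by_contra hlt
    push Not at hlt
    have h3 := (ENNReal.ofReal_lt_ofReal_iff (by positivity)).2 hlt
    exact absurd h1 (not_le.2 h3)
  have h3 : 0 < ‖u‖ ^ 2 := by positivity
  nlinarith

end Form

/-! ### Bessel estimates for orthogonal families of subspaces -/

section Projections

variable {E ι : Type*} [NormedAddCommGroup E] [InnerProductSpace ℝ E]
  {V : ι → Submodule ℝ E} [∀ i, (V i).HasOrthogonalProjection]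

theorem norm_sum_sq_of_orthogonal
    (hV : OrthogonalFamily ℝ (fun i => V i) fun i => (V i).subtypeₗᵢ) (a : ι → ℝ) (w : E)
    (S : Finset ι) :
    ‖∑ i ∈ S, a i • (V i).starProjection w‖ ^ 2 =
      ∑ i ∈ S, a i ^ 2 * ‖(V i).starProjection w‖ ^ 2 := by
  have h := hV.norm_sum (fun i => a i • (V i).orthogonalProjectionOnto w) S
  simp only [Submodule.coe_subtypeₗᵢ, Submodule.subtype_apply, Submodule.coe_smul,
    norm_smul, mul_pow, Real.norm_eq_abs, sq_abs] at h
  exact h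

/-- Bessel's inequality: the projections are symmetric and idempotent, so the inner product of their
sum with `w` is the squared norm of the sum, and Cauchy-Schwarz finishes. -/
theorem sum_norm_sq_starProjection_le
    (hV : OrthogonalFamily ℝ (fun i => V i) fun i => (V i).subtypeₗᵢ) (w : E) (S : Finset ι) :
    ∑ i ∈ S, ‖(V i).starProjection w‖ ^ 2 ≤ ‖w‖ ^ 2 := by
  have h := norm_sum_sq_of_orthogonal hV (fun _ => 1) w S
  simp only [one_smul, one_pow, one_mul] at h
  have h2 : inner ℝ (∑ i ∈ S, (V i).starProjection w) w =
      ∑ i ∈ S, ‖(V i).starProjection w‖ ^ 2 := by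
    rw [sum_inner]
    refine Finset.sum_congr rfl fun i _ => ?_
    rw [← real_inner_self_eq_norm_sq]
    conv_lhs => rw [← Submodule.starProjection_eq_self_iff.2
      (Submodule.starProjection_apply_mem (V i) w)]
    rw [Submodule.inner_starProjection_left_eq_right]
  have h3 := real_inner_le_norm (∑ i ∈ S, (V i).starProjection w) w
  rw [h2, ← h] at h3
  rw [← h]
  have h4 := norm_nonneg (∑ i ∈ S, (V i).starProjection w)
  have h5 := norm_nonneg w
  nlinarith

theorem sum_mul_norm_sq_le
    (hV : OrthogonalFamily ℝ (fun i => V i) fun i => (V i).subtypeₗᵢ) {b : ι → ℝ} {C : ℝ}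
    (hC : 0 ≤ C) (hb : ∀ i, b i ≤ C) (w : E) (S : Finset ι) :
    ∑ i ∈ S, b i * ‖(V i).starProjection w‖ ^ 2 ≤ C * ‖w‖ ^ 2 :=
  calc _ ≤ ∑ i ∈ S, C * ‖(V i).starProjection w‖ ^ 2 :=
        Finset.sum_le_sum fun i _ => mul_le_mul_of_nonneg_right (hb i) (sq_nonneg _)
    _ = C * ∑ i ∈ S, ‖(V i).starProjection w‖ ^ 2 := Finset.mul_sum .. |>.symm
    _ ≤ _ := mul_le_mul_of_nonneg_left (sum_norm_sq_starProjection_le hV w S) hC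

theorem summable_smul_starProjection [CompleteSpace E]
    (hV : OrthogonalFamily ℝ (fun i => V i) fun i => (V i).subtypeₗᵢ) {a : ι → ℝ} {C : ℝ}
    (ha : ∀ i, a i ^ 2 ≤ C ^ 2) (w : E) :
    Summable fun i => a i • (V i).starProjection w := by
  have h := hV.summable_iff_norm_sq_summable (fun i => a i • (V i).orthogonalProjectionOnto w)
  refine h.2 (summable_of_sum_le (c := C ^ 2 * ‖w‖ ^ 2) (fun i => by positivity) fun S => ?_)
  have h2 := sum_mul_norm_sq_le hV (sq_nonneg C) ha w S
  refine le_trans (le_of_eq (Finset.sum_congr rfl fun i _ => ?_)) h2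
  rw [norm_smul, mul_pow, Real.norm_eq_abs, sq_abs]
  rfl

end Projections

/-! ### Eigenspaces of `B`: orthogonality and second moments -/

section Eigenspaces

theorem isHermiteStokes_of_mem_span {μ : ℝ} {u : H}
    (hu : u ∈ Submodule.span ℝ {u : H | IsHermiteStokes u (μ • u)}) :
    IsHermiteStokes u (μ • u) := by
  induction hu using Submodule.span_induction with
  | mem x h => exact h
  | zero => simpa using isHermiteStokes_zero
  | add x y _ _ hx hy => simpa only [smul_add] using hx.add hy
  | smul a x _ hx => simpa only [smul_comm μ a] using hx.smul a

/-- The eigenspace is defined as a closure, and its elements are not known here to lie in `D(B)`.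
Facts about eigenvectors are transferred to them along such sequences. -/
theorem exists_seq_of_mem_eigenspaceB {μ : ℝ} {u : H} (hu : u ∈ eigenspaceB μ) :
    ∃ e : ℕ → H, (∀ n, IsHermiteStokes (e n) (μ • e n)) ∧ Tendsto e atTop (𝓝 u) := by
  have h : u ∈ closure (Submodule.span ℝ {u : H | IsHermiteStokes u (μ • u)} : Set H) := hu
  obtain ⟨e, he, hlim⟩ := mem_closure_iff_seq_limit.1 h
  exact ⟨e, fun n => isHermiteStokes_of_mem_span (he n), hlim⟩

theorem inner_eq_zero_of_mem_eigenspaceB {μ ν : ℝ} (hμν : μ ≠ ν) {u v : H}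
    (hu : u ∈ eigenspaceB μ) (hv : v ∈ eigenspaceB ν) : inner ℝ u v = 0 := by
  obtain ⟨e, he, hel⟩ := exists_seq_of_mem_eigenspaceB hu
  obtain ⟨f, hf, hfl⟩ := exists_seq_of_mem_eigenspaceB hv
  refine tendsto_nhds_unique (hel.inner hfl) ?_
  have : ∀ n, (inner ℝ (e n) (f n) : ℝ) = 0 := fun n => by
    have h := (he n).inner_comm (hf n)
    rw [inner_smul_left_H, inner_smul_right_H] at h
    have h2 : (μ - ν) * inner ℝ (e n) (f n) = 0 := by linarith
    exact (mul_eq_zero.1 h2).resolve_left (sub_ne_zero.2 hμν)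
  simp only [this]
  exact tendsto_const_nhds

theorem orthogonalFamily_eigenspaceB :
    OrthogonalFamily ℝ (fun μ : eigenvaluesB => eigenspaceB (μ : ℝ))
      fun μ => (eigenspaceB (μ : ℝ)).subtypeₗᵢ :=
  fun _ _ h u v => inner_eq_zero_of_mem_eigenspaceB (Subtype.coe_injective.ne h) u.2 v.2

theorem moment_le_of_tendsto {f : ℕ → H} {g : H} (hf : Tendsto f atTop (𝓝 g)) {M : ℕ → ℝ≥0∞}
    {M' : ℝ≥0∞} (hM : Tendsto M atTop (𝓝 M')) (h : ∀ n, moment (f n : L2) ≤ M n) :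
    moment (g : L2) ≤ M' :=
  lintegral_weight_le_of_tendsto (w := fun _ x => ‖x‖ₑ ^ 2)
    (fun _ => measurable_enorm.pow_const 2) (fun _ => tendsto_const_nhds)
    (ae_of_all _ fun x => by finiteness)
    (h := fun n => (f n : L2)) ((continuous_subtype_val.tendsto g).comp hf) hM h

/-- For genuine eigenvectors the moment is at most the form `2⟨Bu, u⟩`, the gradient part being
dropped. Approximating each `p μ`, the form converges to its value at the limit, where orthogonality
removes the cross terms, and the moment is lower semicontinuous. -/
theorem moment_sum_eigenspaceB_le {S : Finset eigenvaluesB} {p : eigenvaluesB → H}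
    (hp : ∀ μ ∈ S, p μ ∈ eigenspaceB (μ : ℝ)) :
    moment ((∑ μ ∈ S, p μ : H) : L2) ≤ ENNReal.ofReal (2 * ∑ μ ∈ S, (μ : ℝ) * ‖p μ‖ ^ 2) := by
  have hex : ∀ μ : eigenvaluesB, ∃ e : ℕ → H, μ ∈ S →
      (∀ n, IsHermiteStokes (e n) ((μ : ℝ) • e n)) ∧ Tendsto e atTop (𝓝 (p μ)) := fun μ => by
    by_cases hμ : μ ∈ S
    · obtain ⟨e, he⟩ := exists_seq_of_mem_eigenspaceB (hp μ hμ)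
      exact ⟨e, fun _ => he⟩
    -- A dummy value off `S`, so that the sequences can be chosen for all `μ` at once.
    · exact ⟨0, fun h => absurd h hμ⟩
  choose e he using hex
  have hlim : Tendsto (fun n => ∑ μ ∈ S, e μ n) atTop (𝓝 (∑ μ ∈ S, p μ)) :=
    tendsto_finsetSum S fun μ hμ => (he μ hμ).2
  have hlim' : Tendsto (fun n => ∑ μ ∈ S, (μ : ℝ) • e μ n) atTop
      (𝓝 (∑ μ ∈ S, (μ : ℝ) • p μ)) :=
    tendsto_finsetSum S fun μ hμ => ((he μ hμ).2).const_smul _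
  have hin : inner ℝ (∑ μ ∈ S, (μ : ℝ) • p μ) (∑ μ ∈ S, p μ) =
      ∑ μ ∈ S, (μ : ℝ) * ‖p μ‖ ^ 2 := by
    rw [sum_inner]
    refine Finset.sum_congr rfl fun μ hμ => ?_
    rw [inner_smul_left_H, inner_sum, Finset.sum_eq_single_of_mem μ hμ, real_inner_self_eq_norm_sq]
    intro ν hν hne
    exact inner_eq_zero_of_mem_eigenspaceB (Subtype.coe_injective.ne hne.symm) (hp μ hμ) (hp ν hν)
  rw [← hin]
  refine moment_le_of_tendsto hlim
    (ENNReal.tendsto_ofReal ((hlim'.inner hlim).const_mul 2)) fun n => ?_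
  exact le_self_add.trans_eq
    (isHermiteStokes_sum S fun μ hμ => (he μ hμ).1 n).form_eq

end Eigenspaces

/-! ### Norm and second moment of `B^{-β} w` -/

section NegPow

variable {β l : ℝ}

/-- Here and below `l` is any positive lower bound of the eigenvalues: `1/2` serves for existence,
`λ₁` for the final estimate. -/
theorem rpow_neg_sq_le (hβ : 0 ≤ β) (hl : 0 < l) (hle : ∀ μ ∈ eigenvaluesB, l ≤ μ)
    (μ : eigenvaluesB) : ((μ : ℝ) ^ (-β)) ^ 2 ≤ (l ^ (-β)) ^ 2 :=
  pow_le_pow_left₀ (Real.rpow_nonneg (hl.le.trans (hle μ μ.2)) _)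
    (Real.rpow_le_rpow_of_nonpos hl (hle μ μ.2) (neg_nonpos.2 hβ)) 2

theorem hasSum_negPowB (hβ : 0 ≤ β) (hl : 0 < l) (hle : ∀ μ ∈ eigenvaluesB, l ≤ μ) (w : H) :
    HasSum (fun μ : eigenvaluesB => (μ : ℝ) ^ (-β) • (eigenspaceB (μ : ℝ)).starProjection w)
      (negPowB β w) :=
  (summable_smul_starProjection orthogonalFamily_eigenspaceB
    (rpow_neg_sq_le hβ hl hle) w).hasSum

theorem negPowB_add (hβ : 0 ≤ β) (hl : 0 < l) (hle : ∀ μ ∈ eigenvaluesB, l ≤ μ) (w w' : H) :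
    negPowB β (w + w') = negPowB β w + negPowB β w' := by
  refine (hasSum_negPowB hβ hl hle (w + w')).unique ?_
  simpa only [map_add, smul_add] using
    (hasSum_negPowB hβ hl hle w).add (hasSum_negPowB hβ hl hle w')

theorem negPowB_smul (hβ : 0 ≤ β) (hl : 0 < l) (hle : ∀ μ ∈ eigenvaluesB, l ≤ μ) (a : ℝ) (w : H) :
    negPowB β (a • w) = a • negPowB β w := by
  refine (hasSum_negPowB hβ hl hle (a • w)).unique ?_
  simpa only [map_smul, smul_comm a] using (hasSum_negPowB hβ hl hle w).const_smul a

theorem norm_negPowB_le (hβ : 0 ≤ β) (hl : 0 < l) (hle : ∀ μ ∈ eigenvaluesB, l ≤ μ) (w : H) :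
    ‖negPowB β w‖ ≤ l ^ (-β) * ‖w‖ := by
  refine le_of_tendsto (hasSum_negPowB hβ hl hle w).norm (Eventually.of_forall fun S => ?_)
  refine le_of_sq_le_sq ?_ (by positivity)
  rw [norm_sum_sq_of_orthogonal orthogonalFamily_eigenspaceB, mul_pow]
  exact sum_mul_norm_sq_le orthogonalFamily_eigenspaceB (sq_nonneg _)
    (rpow_neg_sq_le hβ hl hle) w S

/-- The form weighs the component of `B^{-β} w` at `μ` by `μ · μ^{-2β} = μ^{1-2β}`, which decreases
in `μ` once `β ≥ 1/2`. -/
theorem moment_negPowB_le (hβ : 1 / 2 ≤ β) (hl : 0 < l) (hle : ∀ μ ∈ eigenvaluesB, l ≤ μ)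
    (w : H) : moment (negPowB β w : L2) ≤ ENNReal.ofReal (2 * (l ^ (1 - 2 * β) * ‖w‖ ^ 2)) := by
  have hsum := hasSum_negPowB (β := β) (by linarith) hl hle w
  -- The partial sums form a net over finite sets, whereas the Fatou argument needs a sequence; one
  -- is extracted from the closure.
  have hmem : negPowB β w ∈ closure (Set.range fun S : Finset eigenvaluesB =>
      ∑ μ ∈ S, (μ : ℝ) ^ (-β) • (eigenspaceB (μ : ℝ)).starProjection w) :=
    mem_closure_of_tendsto hsum (Eventually.of_forall fun S => Set.mem_range_self S)
  obtain ⟨f, hf, hlim⟩ := mem_closure_iff_seq_limit.1 hmem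
  refine moment_le_of_tendsto hlim tendsto_const_nhds fun n => ?_
  obtain ⟨S, hS⟩ := hf n
  rw [← hS]
  refine (moment_sum_eigenspaceB_le fun μ _ => Submodule.smul_mem _ _
    (Submodule.starProjection_apply_mem _ w)).trans (ENNReal.ofReal_le_ofReal ?_)
  refine mul_le_mul_of_nonneg_left ?_ zero_le_two
  refine le_trans (le_of_eq (Finset.sum_congr rfl fun μ _ => ?_))
    (sum_mul_norm_sq_le orthogonalFamily_eigenspaceB (b := fun μ => (μ : ℝ) ^ (1 - 2 * β))
      (by positivity) (fun μ => Real.rpow_le_rpow_of_nonpos hl (hle μ μ.2) (by linarith)) w S)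
  have hμ : 0 < (μ : ℝ) := hl.trans_le (hle μ μ.2)
  have h1 : (μ : ℝ) ^ (1 - 2 * β) = μ * ((μ : ℝ) ^ (-β)) ^ 2 := by
    rw [← Real.rpow_natCast, ← Real.rpow_mul hμ.le]
    conv_rhs => rw [← Real.rpow_one (μ : ℝ), ← Real.rpow_mul hμ.le, ← Real.rpow_add hμ]
    congr 1
    push_cast
    ring
  have h2 : ‖(μ : ℝ) ^ (-β) • (eigenspaceB (μ : ℝ)).starProjection w‖ =
      (μ : ℝ) ^ (-β) * ‖(eigenspaceB (μ : ℝ)).starProjection w‖ := by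
    rw [norm_smul, Real.norm_of_nonneg (Real.rpow_nonneg hμ.le _)]
  rw [h2, h1]
  ring

end NegPow

/-! ### Integrability of `|ξ|^s ĥ` -/

section Weight

/-- In polar coordinates the integrand is `r^{s+2} / (1 + r²)`: it behaves like `r^{s+2}` at `0`,
where `s > -3` is needed, and like `r^s` at infinity, where `s < -1` is needed. -/
theorem integrable_norm_rpow_mul_inv {s : ℝ} (hs : -3 < s) (hs' : s < -1) :
    Integrable fun ξ : E3 => ‖ξ‖ ^ s * (1 + ‖ξ‖ ^ 2)⁻¹ := by
  have h := integrable_fun_norm_addHaar (volume : Measure E3)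
    (f := fun y : ℝ => y ^ s * (1 + y ^ 2)⁻¹)
  refine h.2 ?_
  have hm : Measurable fun y : ℝ => y ^ (Module.finrank ℝ E3 - 1) • (y ^ s * (1 + y ^ 2)⁻¹) := by
    simp only [smul_eq_mul]
    fun_prop
  have hid : ∀ y : ℝ, 0 < y → y ^ (Module.finrank ℝ E3 - 1) • (y ^ s * (1 + y ^ 2)⁻¹) =
      y ^ (s + 2) * (1 + y ^ 2)⁻¹ := fun y hy => by
    rw [finrank_euclideanSpace_fin, smul_eq_mul, Real.rpow_add hy, Real.rpow_two]
    ring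
  rw [← Set.Ioc_union_Ioi_eq_Ioi (zero_le_one' ℝ)]
  refine IntegrableOn.union ?_ ?_
  · have h1 : IntegrableOn (fun y : ℝ => y ^ (s + 2)) (Set.Ioc 0 1) :=
      (intervalIntegrable_iff_integrableOn_Ioc_of_le zero_le_one).1
        (intervalIntegral.intervalIntegrable_rpow' (by linarith))
    refine Integrable.mono' h1 hm.aestronglyMeasurable ?_
    filter_upwards [ae_restrict_mem measurableSet_Ioc] with y hy
    rw [hid y hy.1, Real.norm_of_nonneg (mul_nonneg (Real.rpow_nonneg hy.1.le _) (by positivity))]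
    exact mul_le_of_le_one_right (Real.rpow_nonneg hy.1.le _)
      (inv_le_one_of_one_le₀ (by nlinarith [sq_nonneg y]))
  · have h1 : IntegrableOn (fun y : ℝ => y ^ s) (Set.Ioi 1) :=
      integrableOn_Ioi_rpow_of_lt hs' one_pos
    refine Integrable.mono' h1 hm.aestronglyMeasurable ?_
    filter_upwards [ae_restrict_mem measurableSet_Ioi] with y hy
    have hy0 : (0 : ℝ) < y := one_pos.trans hy
    rw [hid y hy0, Real.norm_of_nonneg (mul_nonneg (Real.rpow_nonneg hy0.le _) (by positivity)),
      Real.rpow_add hy0, Real.rpow_two, mul_assoc]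
    refine mul_le_of_le_one_right (Real.rpow_nonneg hy0.le _) ?_
    rw [← div_eq_mul_inv, div_le_one (by positivity)]
    linarith

theorem integral_mul_le_sqrt_mul_sqrt {α : Type*} [MeasurableSpace α] {μ : Measure α}
    {f g : α → ℝ} (hf0 : ∀ x, 0 ≤ f x) (hg0 : ∀ x, 0 ≤ g x) (hf : MemLp f 2 μ)
    (hg : MemLp g 2 μ) :
    ∫ x, f x * g x ∂μ ≤ √(∫ x, f x ^ 2 ∂μ) * √(∫ x, g x ^ 2 ∂μ) := by
  have h := integral_mul_le_Lp_mul_Lq_of_nonneg (μ := μ) Real.HolderConjugate.two_two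
    (ae_of_all _ hf0) (ae_of_all _ hg0) (by simpa using hf) (by simpa using hg)
  simpa only [Real.rpow_two, Real.sqrt_eq_rpow] using h

theorem integrable_hardy {h : H} {M : ℝ} (hM : moment (h : L2) ≤ ENNReal.ofReal M) :
    Integrable (fun ξ => (‖ξ‖ ^ 2)⁻¹ * ‖fourierL2 h ξ‖ ^ 2) ∧
    (0 ≤ M → ∫ ξ, (‖ξ‖ ^ 2)⁻¹ * ‖fourierL2 h ξ‖ ^ 2 ≤ 16 * Real.pi ^ 2 * M) := by
  have hardy := lintegral_hardy_fourier (toC3.compLp (h : L2))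
  change ∫⁻ ξ, (‖ξ‖ₑ ^ 2)⁻¹ * ‖fourierL2 h ξ‖ₑ ^ 2 ≤ _ * moment (toC3.compLp (h : L2)) at hardy
  rw [moment_toC3] at hardy
  replace hardy := hardy.trans (mul_le_mul_right hM _)
  rw [← ENNReal.ofReal_mul (by positivity)] at hardy
  have hm : AEStronglyMeasurable (fun ξ => (‖ξ‖ ^ 2)⁻¹ * ‖fourierL2 h ξ‖ ^ 2) :=
    (measurable_norm.pow_const 2).inv.aestronglyMeasurable.mul
      ((Lp.aestronglyMeasurable (fourierL2 h)).norm.pow 2)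
  have h0 : ∀ᵐ ξ : E3, ξ ≠ 0 := by simp [ae_iff]
  have heq : ∫⁻ ξ, ENNReal.ofReal ((‖ξ‖ ^ 2)⁻¹ * ‖fourierL2 h ξ‖ ^ 2) =
      ∫⁻ ξ, (‖ξ‖ₑ ^ 2)⁻¹ * ‖fourierL2 h ξ‖ₑ ^ 2 := by
    refine lintegral_congr_ae ?_
    filter_upwards [h0] with ξ hξ
    have hξ' : 0 < ‖ξ‖ := norm_pos_iff.2 hξ
    rw [ENNReal.ofReal_mul (by positivity), ENNReal.ofReal_inv_of_pos (by positivity),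
      ENNReal.ofReal_pow (norm_nonneg _), ENNReal.ofReal_pow (norm_nonneg _), ofReal_norm,
      ofReal_norm]
  rw [← heq] at hardy
  have hnn : 0 ≤ᵐ[volume] fun ξ => (‖ξ‖ ^ 2)⁻¹ * ‖fourierL2 h ξ‖ ^ 2 :=
    ae_of_all _ fun ξ => by positivity
  refine ⟨⟨hm, (hasFiniteIntegral_iff_ofReal hnn).2 (hardy.trans_lt ofReal_lt_top)⟩, fun h0 => ?_⟩
  rw [integral_eq_lintegral_of_nonneg_ae hnn hm]
  exact ENNReal.toReal_le_of_le_ofReal (by positivity) hardy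

/-- Integrability of `|ξ|^s ĥ` for `-5/2 < s < -3/2`, in terms of the norm and the second moment
of `h`. -/
theorem integral_rpow_mul_fourierL2_le {s : ℝ} (hs : -(5 / 2) < s) (hs' : s < -(3 / 2)) {h : H}
    {M : ℝ} (h0 : 0 ≤ M) (hM : moment (h : L2) ≤ ENNReal.ofReal M) :
    Integrable (fun ξ => ‖ξ‖ ^ s * ‖fourierL2 h ξ‖) ∧
    ∫ ξ, ‖ξ‖ ^ s * ‖fourierL2 h ξ‖ ≤
      √(∫ ξ : E3, ‖ξ‖ ^ (2 * s + 2) * (1 + ‖ξ‖ ^ 2)⁻¹) * √(‖h‖ ^ 2 + 16 * Real.pi ^ 2 * M) := by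
  obtain ⟨hi, hb⟩ := integrable_hardy hM
  -- Cauchy-Schwarz with `g² = (1 + |ξ|⁻²)|ĥ|²`, the quantity controlled by Plancherel and Hardy.
  -- The other factor is then forced, and its exponent `2s + 2` lies in `(-3, -1)`.
  set f : E3 → ℝ := fun ξ => √(‖ξ‖ ^ (2 * s + 2) * (1 + ‖ξ‖ ^ 2)⁻¹) with hf
  set g : E3 → ℝ := fun ξ => √(‖fourierL2 h ξ‖ ^ 2 + (‖ξ‖ ^ 2)⁻¹ * ‖fourierL2 h ξ‖ ^ 2) with hg
  have hf2 : ∀ ξ, f ξ ^ 2 = ‖ξ‖ ^ (2 * s + 2) * (1 + ‖ξ‖ ^ 2)⁻¹ := fun ξ =>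
    Real.sq_sqrt (by positivity)
  have hg2 : ∀ ξ, g ξ ^ 2 = ‖fourierL2 h ξ‖ ^ 2 + (‖ξ‖ ^ 2)⁻¹ * ‖fourierL2 h ξ‖ ^ 2 := fun ξ =>
    Real.sq_sqrt (by positivity)
  have hn : Integrable fun ξ => ‖fourierL2 h ξ‖ ^ 2 :=
    (Lp.memLp _).integrable_norm_pow two_ne_zero
  have hfm : MemLp f 2 volume := by
    refine (memLp_two_iff_integrable_sq ?_).2 ?_
    · exact Measurable.aestronglyMeasurable (by fun_prop)
    · simp only [hf2]
      exact integrable_norm_rpow_mul_inv (by linarith) (by linarith)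
  have hgm : MemLp g 2 volume := by
    refine (memLp_two_iff_integrable_sq ?_).2 ?_
    · exact Real.continuous_sqrt.comp_aestronglyMeasurable
        (hn.aestronglyMeasurable.add hi.aestronglyMeasurable)
    · simp only [hg2]
      exact hn.add hi
  have hne : ∀ᵐ ξ : E3, ξ ≠ 0 := by simp [ae_iff]
  have hfg : ∀ᵐ ξ : E3, f ξ * g ξ = ‖ξ‖ ^ s * ‖fourierL2 h ξ‖ := by
    filter_upwards [hne] with ξ hξ
    have hξ' : 0 < ‖ξ‖ := norm_pos_iff.2 hξ
    have h1 : ‖ξ‖ ^ (2 * s + 2) = (‖ξ‖ ^ s) ^ 2 * ‖ξ‖ ^ 2 := by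
      rw [Real.rpow_add hξ', Real.rpow_two, mul_comm 2 s, Real.rpow_mul hξ'.le, Real.rpow_two]
    rw [hf, hg]
    dsimp only
    rw [← Real.sqrt_mul (by positivity), h1,
      ← Real.sqrt_sq (show 0 ≤ ‖ξ‖ ^ s * ‖fourierL2 h ξ‖ by positivity)]
    congr 1
    field_simp
    ring
  have hint : Integrable fun ξ => f ξ * g ξ := hfm.integrable_mul hgm
  refine ⟨hint.congr hfg, ?_⟩
  rw [← integral_congr_ae hfg]
  have hcs := integral_mul_le_sqrt_mul_sqrt (f := f) (g := g) (fun ξ => Real.sqrt_nonneg _)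
    (fun ξ => Real.sqrt_nonneg _) hfm hgm
  simp_rw [hf2, hg2] at hcs
  refine hcs.trans ?_
  refine mul_le_mul_of_nonneg_left (Real.sqrt_le_sqrt ?_) (Real.sqrt_nonneg _)
  rw [integral_add hn hi, integral_norm_sq_eq, fourierL2.norm_map]
  exact add_le_add le_rfl (hb h0)

end Weight

/-! ### From trilinear forms to bilinear maps -/

section Riesz

variable {E : Type*} [NormedAddCommGroup E] [InnerProductSpace ℝ E] [CompleteSpace E]

/-- Bounded trilinear forms on a Hilbert space are given by bounded bilinear maps. -/
theorem exists_bilinear_of_trilinear {τ : E → E → E → ℝ} {C : ℝ} (hC : 0 ≤ C)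
    (add₁ : ∀ u u' v w, τ (u + u') v w = τ u v w + τ u' v w)
    (smul₁ : ∀ (a : ℝ) u v w, τ (a • u) v w = a * τ u v w)
    (add₂ : ∀ u v v' w, τ u (v + v') w = τ u v w + τ u v' w)
    (smul₂ : ∀ (a : ℝ) u v w, τ u (a • v) w = a * τ u v w)
    (add₃ : ∀ u v w w', τ u v (w + w') = τ u v w + τ u v w')
    (smul₃ : ∀ (a : ℝ) u v w, τ u v (a • w) = a * τ u v w)
    (bound : ∀ u v w, |τ u v w| ≤ C * ‖u‖ * ‖v‖ * ‖w‖) :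
    ∃ T : E →L[ℝ] E →L[ℝ] E, ∀ u v w, inner ℝ (T u v) w = τ u v w := by
  let φ : E → E → StrongDual ℝ E := fun u v =>
    LinearMap.mkContinuous
      { toFun := τ u v
        map_add' := add₃ u v
        map_smul' := fun a w => smul₃ a u v w } (C * ‖u‖ * ‖v‖) (bound u v)
  let R : E → E → E := fun u v => (InnerProductSpace.toDual ℝ E).symm (φ u v)
  have hR : ∀ u v w, inner ℝ (R u v) w = τ u v w := fun u v w =>
    InnerProductSpace.toDual_symm_apply
  let B : E →ₗ[ℝ] E →ₗ[ℝ] E := LinearMap.mk₂ ℝ R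
    (fun u u' v => ext_inner_right ℝ fun w => by rw [inner_add_left, hR, hR, hR, add₁])
    (fun a u v => ext_inner_right ℝ fun w => by rw [real_inner_smul_left, hR, hR, smul₁])
    (fun u v v' => ext_inner_right ℝ fun w => by rw [inner_add_left, hR, hR, hR, add₂])
    (fun a u v => ext_inner_right ℝ fun w => by rw [real_inner_smul_left, hR, hR, smul₂])
  refine ⟨B.mkContinuous₂ C fun u v => ?_, fun u v w => hR u v w⟩
  change ‖(InnerProductSpace.toDual ℝ E).symm (φ u v)‖ ≤ _
  rw [LinearIsometryEquiv.norm_map]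
  exact LinearMap.mkContinuous_norm_le _ (by positivity) _

end Riesz

/-! ### The trilinear form and its estimate -/

section Trilinear

/-- The integrand of the Parseval integral of `A^{-β} C(u, v)` and `h`. -/
def convIntegrand (β : ℝ) (u v h : H) (ξ : E3) : ℂ :=
  inner ℂ ((((2 * Real.pi * ‖ξ‖) ^ (-(2 * β)) : ℝ) : ℂ) • fourierConv u v ξ) (fourierL2 h ξ)

variable {β : ℝ}

/-- The multiplier of `A^{-β}` contributes `|ξ|^{-2β}` and the convection term `|ξ|`, whence the
exponent `1 - 2β`. -/
theorem norm_convIntegrand_le (u v h : H) :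
    ∀ᵐ ξ, ‖convIntegrand β u v h ξ‖ ≤
      3 * (2 * Real.pi) ^ (1 - 2 * β) * ‖u‖ * ‖v‖ * (‖ξ‖ ^ (1 - 2 * β) * ‖fourierL2 h ξ‖) := by
  have hne : ∀ᵐ ξ : E3, ξ ≠ 0 := by simp [ae_iff]
  filter_upwards [hne] with ξ hξ
  have hξ' : 0 < ‖ξ‖ := norm_pos_iff.2 hξ
  have hp : 0 < 2 * Real.pi * ‖ξ‖ := by positivity
  refine (norm_inner_le_norm _ _).trans ?_
  rw [norm_smul, Complex.norm_real, Real.norm_of_nonneg (by positivity)]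
  calc _ ≤ (2 * Real.pi * ‖ξ‖) ^ (-(2 * β)) * (3 * (2 * Real.pi * ‖ξ‖) * (‖u‖ * ‖v‖)) *
        ‖fourierL2 h ξ‖ := by
        gcongr
        exact norm_fourierConv_le _ _ _
    _ = _ := by
        rw [show 1 - 2 * β = -(2 * β) + 1 by ring,
          Real.rpow_add hξ', Real.rpow_add (by positivity : 0 < 2 * Real.pi), Real.rpow_one,
          Real.rpow_one, Real.mul_rpow (by positivity) hξ'.le]
        ring

theorem aestronglyMeasurable_convIntegrand (u v h : H) :
    AEStronglyMeasurable (convIntegrand β u v h) := by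
  have h1 : Measurable fun ξ : E3 => (((2 * Real.pi * ‖ξ‖) ^ (-(2 * β)) : ℝ) : ℂ) := by fun_prop
  have h2 : AEStronglyMeasurable (fun ξ : E3 =>
      (((2 * Real.pi * ‖ξ‖) ^ (-(2 * β)) : ℝ) : ℂ) • fourierConv (u : L2) (v : L2) ξ) :=
    h1.aestronglyMeasurable.smul (continuous_fourierConv _ _).aestronglyMeasurable
  exact h2.inner (Lp.aestronglyMeasurable (fourierL2 h))

theorem convIntegrand_add_left (u u' v h : H) (ξ : E3) : convIntegrand β (u + u') v h ξ =
    convIntegrand β u v h ξ + convIntegrand β u' v h ξ := by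
  simp only [convIntegrand, Submodule.coe_add, fourierConv_add_left, smul_add, inner_add_left]

theorem convIntegrand_add_right (u v v' h : H) (ξ : E3) : convIntegrand β u (v + v') h ξ =
    convIntegrand β u v h ξ + convIntegrand β u v' h ξ := by
  simp only [convIntegrand, Submodule.coe_add, fourierConv_add_right, smul_add, inner_add_left]

theorem convIntegrand_smul_left (a : ℝ) (u v h : H) (ξ : E3) : convIntegrand β (a • u) v h ξ =
    a * convIntegrand β u v h ξ := by
  rw [convIntegrand, Submodule.coe_smul, fourierConv_smul_left, ← Complex.coe_smul, smul_comm,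
    inner_smul_left, Complex.conj_ofReal]
  rfl

theorem convIntegrand_smul_right (a : ℝ) (u v h : H) (ξ : E3) : convIntegrand β u (a • v) h ξ =
    a * convIntegrand β u v h ξ := by
  rw [convIntegrand, Submodule.coe_smul, fourierConv_smul_right, ← Complex.coe_smul, smul_comm,
    inner_smul_left, Complex.conj_ofReal]
  rfl

theorem convIntegrand_add_field (u v h h' : H) : convIntegrand β u v (h + h') =ᵐ[volume]
    fun ξ => convIntegrand β u v h ξ + convIntegrand β u v h' ξ := by
  filter_upwards [Lp.coeFn_add (fourierL2 (h : L2)) (fourierL2 (h' : L2))] with ξ hξ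
  rw [convIntegrand, Submodule.coe_add, map_add, hξ, Pi.add_apply, inner_add_right]
  rfl

theorem convIntegrand_smul_field (a : ℝ) (u v h : H) : convIntegrand β u v (a • h) =ᵐ[volume]
    fun ξ => a * convIntegrand β u v h ξ := by
  filter_upwards [Lp.coeFn_smul a (fourierL2 (h : L2))] with ξ hξ
  rw [convIntegrand, Submodule.coe_smul, map_smul, hξ, Pi.smul_apply, ← Complex.coe_smul,
    inner_smul_right]
  rfl

/-- The constant in the trilinear estimate. -/
def trilinearConst (β : ℝ) : ℝ :=
  3 * (2 * Real.pi) ^ (1 - 2 * β) *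
    √(∫ ξ : E3, ‖ξ‖ ^ (2 * (1 - 2 * β) + 2) * (1 + ‖ξ‖ ^ 2)⁻¹)

theorem trilinearConst_nonneg (β : ℝ) : 0 ≤ trilinearConst β := by
  unfold trilinearConst
  positivity

theorem integrable_convIntegrand (hβ : 5 / 4 < β) (hβ' : β < 7 / 4) (u v : H) {h : H} {M : ℝ}
    (h0 : 0 ≤ M) (hM : moment (h : L2) ≤ ENNReal.ofReal M) :
    Integrable (convIntegrand β u v h) :=
  ((integral_rpow_mul_fourierL2_le (by linarith) (by linarith) h0 hM).1.const_mul _).mono'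
    (aestronglyMeasurable_convIntegrand u v h) (norm_convIntegrand_le u v h)

theorem abs_re_integral_convIntegrand_le (hβ : 5 / 4 < β) (hβ' : β < 7 / 4) (u v : H) {h : H}
    {M : ℝ} (h0 : 0 ≤ M) (hM : moment (h : L2) ≤ ENNReal.ofReal M) :
    |(∫ ξ, convIntegrand β u v h ξ).re| ≤
      trilinearConst β * ‖u‖ * ‖v‖ * √(‖h‖ ^ 2 + 16 * Real.pi ^ 2 * M) := by
  obtain ⟨h1, h2⟩ := integral_rpow_mul_fourierL2_le (s := 1 - 2 * β) (by linarith) (by linarith)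
    h0 hM
  refine (Complex.abs_re_le_norm _).trans ?_
  refine (norm_integral_le_of_norm_le (h1.const_mul _) (norm_convIntegrand_le u v h)).trans ?_
  rw [integral_const_mul, trilinearConst]
  refine (mul_le_mul_of_nonneg_left h2 (by positivity)).trans_eq ?_
  ring

end Trilinear

/-! ### The bilinear map and the bound in terms of `λ₁` -/

section Main

variable {β : ℝ}

theorem integrable_convIntegrand_negPowB (hβ : 5 / 4 < β) (hβ' : β < 7 / 4) (u v w : H) :
    Integrable (convIntegrand β u v (negPowB β w)) :=
  integrable_convIntegrand hβ hβ' u v (by positivity)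
    (moment_negPowB_le (l := 1 / 2) (by linarith) one_half_pos
      (fun _ => half_le_of_mem_eigenvaluesB) w)

theorem abs_re_integral_convIntegrand_negPowB_le (hβ : 5 / 4 < β) (hβ' : β < 7 / 4) {l : ℝ}
    (hl : 0 < l) (hle : ∀ μ ∈ eigenvaluesB, l ≤ μ) (u v w : H) :
    |(∫ ξ, convIntegrand β u v (negPowB β w) ξ).re| ≤
      trilinearConst β * √(1 + 32 * Real.pi ^ 2 * l) * l ^ (-β) * ‖u‖ * ‖v‖ * ‖w‖ := by
  refine (abs_re_integral_convIntegrand_le hβ hβ' u v (by positivity)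
    (moment_negPowB_le (by linarith) hl hle w)).trans ?_
  -- Since `l^{1-2β} = l · (l^{-β})²`, both terms carry the factor `(l^{-β} ‖w‖)²`; the extra `l`
  -- stays in the constant.
  have h1 : √(‖negPowB β w‖ ^ 2 + 16 * Real.pi ^ 2 * (2 * (l ^ (1 - 2 * β) * ‖w‖ ^ 2))) ≤
      √(1 + 32 * Real.pi ^ 2 * l) * (l ^ (-β) * ‖w‖) := by
    rw [← Real.sqrt_sq (by positivity : 0 ≤ l ^ (-β) * ‖w‖), ← Real.sqrt_mul (by positivity)]
    refine Real.sqrt_le_sqrt ?_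
    have h2 := pow_le_pow_left₀ (norm_nonneg _)
      (norm_negPowB_le (β := β) (by linarith) hl hle w) 2
    have h3 : l ^ (1 - 2 * β) = l * (l ^ (-β)) ^ 2 := by
      rw [← Real.rpow_natCast, ← Real.rpow_mul hl.le]
      conv_rhs => rw [← Real.rpow_one l, ← Real.rpow_mul hl.le, ← Real.rpow_add hl]
      congr 1
      push_cast
      ring
    rw [h3]
    nlinarith
  refine (mul_le_mul_of_nonneg_left h1
    (mul_nonneg (mul_nonneg (trilinearConst_nonneg β) (norm_nonneg u)) (norm_nonneg v))).trans_eq ?_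
  ring

theorem exists_bilinear_negPowAB (hβ : 5 / 4 < β) (hβ' : β < 7 / 4) :
    ∃ T : H →L[ℝ] H →L[ℝ] H, ∀ u v w,
      inner ℝ (T u v) w = (∫ ξ, convIntegrand β u v (negPowB β w) ξ).re := by
  have hle : ∀ μ ∈ eigenvaluesB, (1 / 2 : ℝ) ≤ μ := fun _ => half_le_of_mem_eigenvaluesB
  have hi := fun u v w => integrable_convIntegrand_negPowB hβ hβ' u v w
  have hb0 : 0 ≤ β := by linarith
  refine exists_bilinear_of_trilinear (C := trilinearConst β * √(1 + 32 * Real.pi ^ 2 * (1 / 2)) *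
      (1 / 2) ^ (-β)) (by have := trilinearConst_nonneg β; positivity) ?_ ?_ ?_ ?_ ?_ ?_
    (abs_re_integral_convIntegrand_negPowB_le hβ hβ' one_half_pos hle)
  · intro u u' v w
    simp only [convIntegrand_add_left]
    rw [integral_add (hi u v w) (hi u' v w), Complex.add_re]
  · intro a u v w
    simp only [convIntegrand_smul_left]
    rw [integral_const_mul, Complex.re_ofReal_mul]
  · intro u v v' w
    simp only [convIntegrand_add_right]
    rw [integral_add (hi u v w) (hi u v' w), Complex.add_re]
  · intro a u v w
    simp only [convIntegrand_smul_right]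
    rw [integral_const_mul, Complex.re_ofReal_mul]
  · intro u v w w'
    rw [negPowB_add hb0 one_half_pos hle, integral_congr_ae (convIntegrand_add_field u v _ _),
      integral_add (hi u v w) (hi u v w'), Complex.add_re]
  · intro a u v w
    rw [negPowB_smul hb0 one_half_pos hle, integral_congr_ae (convIntegrand_smul_field a u v _),
      integral_const_mul, Complex.re_ofReal_mul]

theorem negPowB_eq_zero (h : eigenvaluesB = ∅) (β : ℝ) (w : H) : negPowB β w = 0 := by
  have : IsEmpty eigenvaluesB := Set.isEmpty_coe_sort.2 h
  exact tsum_empty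

theorem abs_inner_negPowAB_le (hβ : 5 / 4 < β) (hβ' : β < 7 / 4) (u v w : H) :
    |(∫ ξ, convIntegrand β u v (negPowB β w) ξ).re| ≤
      trilinearConst β * √(1 + 32 * Real.pi ^ 2 * lambda1) * lambda1 ^ (-β) *
        ‖u‖ * ‖v‖ * ‖w‖ := by
  rcases Set.eq_empty_or_nonempty eigenvaluesB with h | h
  -- That `B` has an eigenvalue is not proved, so the empty case is treated separately: then `B^{-β}
  -- w` is an empty sum and the left side is `0`, while `λ₁ = sInf ∅ = 0` keeps the right side
  -- nonnegative.
  · have hM : moment ((0 : H) : L2) ≤ ENNReal.ofReal 0 := by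
      have h0 := isHermiteStokes_zero.form_eq
      rw [inner_zero_right, mul_zero] at h0
      exact le_self_add.trans_eq h0
    have h1 := abs_re_integral_convIntegrand_le hβ hβ' u v le_rfl hM
    rw [negPowB_eq_zero h]
    refine h1.trans ?_
    rw [norm_zero, mul_zero, add_zero, zero_pow two_ne_zero, Real.sqrt_zero, mul_zero]
    have h2 : 0 ≤ lambda1 := by rw [lambda1, h, Real.sInf_empty]
    have := trilinearConst_nonneg β
    positivity
  · have hbdd : BddBelow eigenvaluesB := ⟨1 / 2, fun _ => half_le_of_mem_eigenvaluesB⟩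
    have hl : 1 / 2 ≤ lambda1 := le_csInf h fun _ => half_le_of_mem_eigenvaluesB
    exact abs_re_integral_convIntegrand_negPowB_le (l := lambda1) hβ hβ' (one_half_pos.trans_le hl)
      (fun μ hμ => csInf_le hbdd hμ) u v w

end Main

end HermiteStokes

end

theorem theorem3 (ε δ : ℝ) (hε0 : 0 < ε) (hε1 : ε < 1 / 2) (hδ : δ = 1 / 4 + ε / 2) :
    ∃ c : ℝ, 0 < c ∧
      ∃ T : HermiteStokes.H →L[ℝ] HermiteStokes.H →L[ℝ] HermiteStokes.H,
        (∀ u ∈ HermiteStokes.stokesDomain, ∀ v ∈ HermiteStokes.stokesDomain,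
          ∃ F : HermiteStokes.H, HermiteStokes.IsConvection u v F ∧
            HermiteStokes.IsNegPowAB (1 + δ) F (T u v)) ∧
        ∀ u v w : HermiteStokes.H,
          |inner ℝ (T u v) w| ≤
            c * HermiteStokes.lambda1 ^ (-(1 + δ)) * ‖u‖ * ‖v‖ * ‖w‖ := by
  have hβ : 5 / 4 < 1 + δ := by linarith
  have hβ' : 1 + δ < 7 / 4 := by linarith
  obtain ⟨T, hT⟩ := HermiteStokes.exists_bilinear_negPowAB hβ hβ'
  have h0 := HermiteStokes.trilinearConst_nonneg (1 + δ)
  have hl : 0 ≤ HermiteStokes.lambda1 :=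
    Real.sInf_nonneg fun μ hμ => one_half_pos.le.trans
      (HermiteStokes.half_le_of_mem_eigenvaluesB hμ)
  -- The constant depends on `ε` only, `λ₁` being a fixed number. The summand `1` makes it strictly
  -- positive.
  refine ⟨HermiteStokes.trilinearConst (1 + δ) *
    √(1 + 32 * Real.pi ^ 2 * HermiteStokes.lambda1) + 1, by positivity, T, ?_, ?_⟩
  · intro u hu v hv
    obtain ⟨F, hF, hFg⟩ := HermiteStokes.exists_isConvection hu hv
    refine ⟨F, hF, fun w => ?_⟩
    -- The integrand that defines `T` contains no `ℙ`. Since `B^{-β} w` is solenoidal, it agrees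
    -- almost everywhere with the Parseval integrand of `A^{-β} F`.
    have hae : HermiteStokes.convIntegrand (1 + δ) u v (HermiteStokes.negPowB (1 + δ) w)
        =ᵐ[volume] fun ξ => inner ℂ (HermiteStokes.fourierNegPowA (1 + δ) F ξ)
          (HermiteStokes.fourierField (HermiteStokes.negPowB (1 + δ) w) ξ) := by
      filter_upwards [hFg (HermiteStokes.negPowB (1 + δ) w)] with ξ hξ
      rw [HermiteStokes.fourierNegPowA, inner_smul_left, hξ, ← inner_smul_left]
      rfl
    exact ⟨(HermiteStokes.integrable_convIntegrand_negPowB hβ hβ' u v w).congr hae,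
      by rw [hT, integral_congr_ae hae]⟩
  · intro u v w
    rw [hT]
    refine (HermiteStokes.abs_inner_negPowAB_le hβ hβ' u v w).trans ?_
    gcongr
    exact le_add_of_nonneg_right zero_le_one
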